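/- Let $d\ge 1$, let $\mathbb S^d$ be the unit sphere of $\mathbb R^{d+1}$ with surface measure $\sigma$ and angular distance $d_{\mathbb S^d}$, and let $b>1$, $s>0$. Let $X^{(i)}(\boldsymbol u)$, $\boldsymbol u\in\mathbb R^{d+1}$, $i=0,1,2,\dots$, be independent identically distributed homogeneous isotropic Gaussian random fields with mean $0$, variance $s^2$ and covariance $E X^{(i)}(\boldsymbol u)X^{(i)}(\boldsymbol v)=r(\|\boldsymbol u-\boldsymbol v\|)$, where $r$ is non-increasing on $[0,\infty)$. For $\boldsymbol\theta\in\mathbb S^d$ and Borel $B\subset\mathbb S^d$ put $$\Lambda^{(i)}(\boldsymbol\theta)=\frac{e^{X^{(i)}(b^i\boldsymbol\theta)}}{E e^{X^{(i)}(b^i\boldsymbol\theta)}},\qquad \mu_n(B)=\int_B\prod_{i=0}^n\Lambda^{(i)}(\boldsymbol\theta)\,\sigma(d\boldsymbol\theta).$$ Assume that for an integer $p\ge 2$ $$b>\exp\Big(\frac{p(p-1)s^2}{2d}\Big),\qquad \sum_{i=0}^\infty r(b^i)<\infty,\qquad \sum_{i=0}^\infty\big(s^2-r(b^{-i})\big)<\infty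 .$$ Let $\Delta_l=\{\Delta_l^{(m)}\}_m$, $l=0,1,2,\dots$, be a dyadic decomposition of $\mathbb S^d$: nested finite Borel partitions of $\mathbb S^d$ such that, for some constants $c,C>0$, every cell $\Delta_l^{(m)}$ contains a closed cap of angular radius $c2^{-l}$ and is contained in the cap of angular radius $C2^{-l}$ with the same centre. Let $\mathfrak B$ be a countable system of Borel sets containing all these cells, and let $\mu$ be a limiting random measure on $\mathbb S^d$: $\mu_n(B)\to\mu(B)$ with probability $1$ for every $B\in\mathfrak B$. Then the Rényi function of $\mu$, $$\tau_\mu(q)=\liminf_{l\to\infty}\frac{\log\Big(\sum_{m}E\,\mu(\Delta_l^{(m)})^q\Big)}{\log\sigma(\Delta_l^{(0)})},$$ is $$\tau_\mu(q)=-\frac{s^2}{2d\ln b}\,q^2+\Big(\frac{s^2}{2d\ln b}+1\Big)q-1,\qquad q\in[0,p].$$ -/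

import Mathlib

open MeasureTheory ProbabilityTheory Filter Topology Set
open scoped ENNReal

noncomputable section

/-- The ambient Euclidean space `ℝ^{d+1}`. -/
abbrev Amb (d : ℕ) : Type := EuclideanSpace ℝ (Fin (d + 1))

/-- The unit sphere `𝕊^d` of `ℝ^{d+1}`. -/
abbrev Sph (d : ℕ) : Type := Metric.sphere (0 : Amb d) 1

/-- The Lebesgue (surface) measure `σ` on `𝕊^d`. -/
def surf (d : ℕ) : Measure (Sph d) := (volume : Measure (Amb d)).toSphere

/-- The angular (great circle) distance on `𝕊^d`. -/
def angDist {d : ℕ} (x y : Sph d) : ℝ := InnerProductGeometry.angle (x : Amb d) (y : Amb d)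

/-- The closed spherical cap `B_u(θ)` of angular radius `u`. -/
def sphCap {d : ℕ} (u : ℝ) (θ : Sph d) : Set (Sph d) := {η | angDist η θ ≤ u}

/-- A dyadic decomposition of `𝕊^d`: at each level `l` a finite Borel partition
`Δ_l = {cell l m : m < N l}`, with the partitions nested, and with each cell of level `l` squeezed
between two concentric caps whose radii are `2^{-l}` times constants that do not depend on
the cell or on the level. -/
structure DyadicDecomposition (d : ℕ) where
  /-- The number of cells of level `l`. -/
  N : ℕ → ℕ
  /-- The cell `Δ_l^{(m)}`, for `m < N l`. -/
  cell : ℕ → ℕ → Set (Sph d)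
  measurableSet_cell : ∀ l, ∀ m < N l, MeasurableSet (cell l m)
  cover : ∀ l, ∀ θ : Sph d, ∃ m < N l, θ ∈ cell l m
  disjoint : ∀ l, ∀ m < N l, ∀ m' < N l, m ≠ m' → Disjoint (cell l m) (cell l m')
  nested : ∀ l l', l ≤ l' → ∀ m < N l, ∀ m' < N l',
    cell l' m' ⊆ cell l m ∨ Disjoint (cell l' m') (cell l m)
  squeezed : ∃ c C : ℝ, 0 < c ∧ 0 < C ∧ ∀ l, ∀ m < N l, ∃ θ : Sph d,
    sphCap (c * (2 : ℝ) ^ (-(l : ℤ))) θ ⊆ cell l m ∧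
      cell l m ⊆ sphCap (C * (2 : ℝ) ^ (-(l : ℤ))) θ

section Fields

variable {Ω : Type*} [MeasurableSpace Ω] {d : ℕ}

/-- The Rényi function
`τ_μ(q) = liminf_l log (∑_m E μ^q(Δ_l^{(m)})) / log |Δ_l^{(0)}|` of a random measure `μ`.
It is computed in the extended reals, so that infinite moments are not given junk values. -/
def renyi (P : Measure Ω) (D : DyadicDecomposition d) (μ : Ω → Measure (Sph d)) (q : ℝ) : EReal :=
  liminf (fun l : ℕ =>
    ENNReal.log (∑ m ∈ Finset.range (D.N l), ∫⁻ ω, (μ ω (D.cell l m)) ^ q ∂P) /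
      ENNReal.log (surf d (D.cell l 0))) atTop

/-- The geometric Gaussian spherical field
`Λ^{(i)}(θ) = exp X^{(i)}(b^i, θ) / E exp X^{(i)}(b^i, θ)`, where `(b^i, θ)` is the point
of `ℝ^{d+1}` at distance `b^i` from the origin in the direction `θ`. -/
def geomField (P : Measure Ω) (b : ℝ) (X : ℕ → Amb d → Ω → ℝ) (i : ℕ) (θ : Sph d) (ω : Ω) : ℝ :=
  Real.exp (X i (b ^ i • (θ : Amb d)) ω) / ∫ ω', Real.exp (X i (b ^ i • (θ : Amb d)) ω') ∂P

/-- The product `Λ_n = ∏_{i=0}^n Λ^{(i)}`. -/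
def prodField (P : Measure Ω) (b : ℝ) (X : ℕ → Amb d → Ω → ℝ) (n : ℕ) (θ : Sph d) (ω : Ω) : ℝ :=
  ∏ i ∈ Finset.range (n + 1), geomField P b X i θ ω

/-- The cumulative random measure `μ_n(B) = ∫_B Λ_n(θ) σ(dθ)`. -/
def cumMeasure (P : Measure Ω) (b : ℝ) (X : ℕ → Amb d → Ω → ℝ) (n : ℕ) (ω : Ω) :
    Measure (Sph d) :=
  (surf d).withDensity fun θ => ENNReal.ofReal (prodField P b X n θ ω)

/-- `X^{(i)}`, `i ∈ ℕ`, are independent, identically distributed, homogeneous and isotropic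
Gaussian random fields on `ℝ^{d+1}` with zero mean, variance `s²` and covariance function
`r(‖u - v‖)`. A centred Gaussian field is determined in law by its covariance function, so the last
three fields make the `X^{(i)}` identically distributed, homogeneous and isotropic.
The random fields `θ ↦ Λ^{(i)}(θ)` on the sphere are jointly measurable. -/
structure IsGeomGaussianModel (P : Measure Ω) (b s : ℝ) (r : ℝ → ℝ)
    (X : ℕ → Amb d → Ω → ℝ) : Prop where
  measurable : ∀ i u, Measurable (X i u)
  measurable_sphere : ∀ i, Measurable fun z : Sph d × Ω => geomField P b X i z.1 z.2
  indep : iIndepFun (fun (i : ℕ) (ω : Ω) (u : Amb d) => X i u ω) P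
  gaussian : ∀ i, IsGaussianProcess (X i) P
  mean : ∀ i u, ∫ ω, X i u ω ∂P = 0
  variance : ∀ i u, ∫ ω, X i u ω ^ 2 ∂P = s ^ 2
  covariance : ∀ i u v, ∫ ω, X i u ω * X i v ω ∂P = r ‖u - v‖

/-- The random measure `μ` is a limiting measure of the `μ_n` on the system `𝔅` of Borel sets:
for all `B ∈ 𝔅`, `μ_n(B) → μ(B)` with probability `1`. -/
def IsLimitingMeasure (P : Measure Ω) (b : ℝ) (X : ℕ → Amb d → Ω → ℝ) (𝔅 : Set (Set (Sph d)))
    (μ : Ω → Measure (Sph d)) : Prop :=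
  Measurable μ ∧ ∀ B ∈ 𝔅, ∀ᵐ ω ∂P,
    Tendsto (fun n => cumMeasure P b X n ω B) atTop (𝓝 (μ ω B))

end Fields

end

/-! ### Surface measure of spherical balls. -/

section Geometry

/-! Match a cell `A` of level `l` with the integer `n` such that `b ^ n ≤ 2 ^ l < b ^ (n + 1)`. The
fields of index `i < n` hardly vary over `A`, so `μ(A)` should be `σ(A)` times their product at a
point `θ₀` of `A`, times a factor of order one. Then `E μ(A)^q` is comparable to `exp(n s²(q² -
q)/2) σ(A)^q`. Since `n` is about `l ln 2 / ln b`, and there are about `2^(ld)` cells of measure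
about `2^(-ld)`, the quotient of logarithms converges to the quadratic polynomial.

The factor of order one is `relMass`, and its `q`-th moment is taken under `tiltedLaw`, the law
tilted by the `q`-th power of the low-frequency product; `lintegral_rpow_eq` is the change of
measure. By `lintegral_rpow_bounds` it suffices to bound, uniformly in the cell and for all late
approximations `μ_N`, the first moment of `relMass` from below and its `p`-th moment from above, so
real exponents never have to be expanded.

These integer moments are integrals of Gaussian exponentials over `k` points of `A`
(`lintegral_relMass_pow`). Low frequencies change the exponent by a bounded amount because the
defects `s² - r(b^(-i))` are summable (`exists_abs_sum_tiltExponent_sub_le`). High frequencies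
contribute only through pairs of distinct points. For `k = 1` there are none. For `k = p` one
reduces to a single pair, whose kernel grows by `exp(p(p-1)s²/2)` per scale while balls shrink by
`b^(-d)`; the hypothesis on `b` makes the geometric series converge (`exp_sum_kernel_le`,
`exists_lintegral_kernel_le`). -/

lemma dist_sq_eq_angDist {d : ℕ} (x y : Sph d) :
    dist x y ^ 2 = 2 - 2 * Real.cos (angDist x y) := by
  have hx : ‖(x : Amb d)‖ = 1 := by simp
  have hy : ‖(y : Amb d)‖ = 1 := by simp
  rw [Subtype.dist_eq, dist_eq_norm, norm_sub_sq_real, angDist, InnerProductGeometry.cos_angle,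
    hx, hy]
  ring

lemma dist_le_angDist {d : ℕ} (x y : Sph d) : dist x y ≤ angDist x y := by
  have h0 : 0 ≤ angDist x y := InnerProductGeometry.angle_nonneg _ _
  refine abs_le_of_sq_le_sq' ?_ h0 |>.2
  rw [dist_sq_eq_angDist]
  linarith [Real.one_sub_sq_div_two_le_cos (x := angDist x y)]

/-- Quadratic upper bound for the cosine on `[-π, π]`; the sharp factor is `π / 2`, and `π < 4`
rounds it up to 2. -/
lemma angDist_le_mul_dist {d : ℕ} (x y : Sph d) : angDist x y ≤ 2 * dist x y := by
  have h0 : 0 ≤ angDist x y := InnerProductGeometry.angle_nonneg _ _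
  have hpi : angDist x y ≤ Real.pi := InnerProductGeometry.angle_le_pi _ _
  refine abs_le_of_sq_le_sq' ?_ (by positivity) |>.2
  have h1 := Real.cos_le_one_sub_mul_cos_sq (x := angDist x y) (by rwa [abs_of_nonneg h0])
  have h2 : (1 : ℝ) / 8 ≤ 2 / Real.pi ^ 2 := by
    rw [div_le_div_iff₀ (by norm_num) (by positivity)]
    nlinarith [Real.pi_lt_four, Real.pi_pos]
  rw [mul_pow, dist_sq_eq_angDist]
  nlinarith [sq_nonneg (angDist x y)]

/-- The part of the cone over `B` between the radii `1` and `1 + u`. -/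
def annularSector {d : ℕ} (B : Set (Sph d)) (u : ℝ) : Set (Amb d) :=
  (↑) '' (homeomorphUnitSphereProd (Amb d) ⁻¹' (B ×ˢ {t | 1 ≤ t.1 ∧ t.1 < 1 + u}))

lemma mem_annularSector {d : ℕ} {B : Set (Sph d)} {u : ℝ} {x : Amb d} :
    x ∈ annularSector B u ↔ ∃ θ ∈ B, ∃ t : ℝ, 1 ≤ t ∧ t < 1 + u ∧ x = t • (θ : Amb d) := by
  constructor
  · rintro ⟨z, ⟨hz1, hz2⟩, rfl⟩
    refine ⟨_, hz1, _, hz2.1, hz2.2, ?_⟩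
    have := congrArg Subtype.val ((homeomorphUnitSphereProd (Amb d)).symm_apply_apply z)
    rw [homeomorphUnitSphereProd_symm_apply_coe] at this
    exact this.symm
  · rintro ⟨θ, hθ, t, h1, h2, rfl⟩
    refine ⟨(homeomorphUnitSphereProd (Amb d)).symm (θ, ⟨t, lt_of_lt_of_le one_pos h1⟩), ?_, by
      simp⟩
    simp [hθ, h1, h2]

lemma volumeIoiPow_shell (n : ℕ) {u : ℝ} (hu : 0 ≤ u) :
    Measure.volumeIoiPow n {t | 1 ≤ t.1 ∧ t.1 < 1 + u} =
      ENNReal.ofReal (((1 + u) ^ (n + 1) - 1) / (n + 1)) := by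
  have hs : {t : Ioi (0 : ℝ) | 1 ≤ t.1 ∧ t.1 < 1 + u} =
      Iio (⟨1 + u, mem_Ioi.2 (by positivity)⟩ : Ioi (0 : ℝ)) \
        Iio (⟨1, mem_Ioi.2 one_pos⟩ : Ioi (0 : ℝ)) := by
    ext t
    simp only [mem_ofPred_eq, Set.mem_sdiff, mem_Iio, not_lt, ← Subtype.coe_lt_coe]
    tauto
  rw [hs, measure_sdiff _ measurableSet_Iio.nullMeasurableSet, Measure.volumeIoiPow_apply_Iio,
    Measure.volumeIoiPow_apply_Iio, ← ENNReal.ofReal_sub _ (by positivity)]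
  · congr 1
    simp only [one_pow]
    ring
  · rw [Measure.volumeIoiPow_apply_Iio]; exact ENNReal.ofReal_ne_top
  · intro t ht
    simp only [mem_Iio, ← Subtype.coe_lt_coe] at ht ⊢
    linarith

/-- Polar coordinates turn Lebesgue measure into a product, so surface measure can be read off from
volumes of Euclidean balls. -/
lemma volume_annularSector {d : ℕ} {B : Set (Sph d)} (hB : MeasurableSet B) {u : ℝ} (hu : 0 ≤ u) :
    (volume : Measure (Amb d)) (annularSector B u) =
      surf d B * ENNReal.ofReal (((1 + u) ^ (d + 1) - 1) / (d + 1)) := by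
  have hm : MeasurableSet {t : Ioi (0 : ℝ) | 1 ≤ t.1 ∧ t.1 < 1 + u} :=
    (measurableSet_le measurable_const measurable_subtype_coe).inter
      (measurableSet_lt measurable_subtype_coe measurable_const)
  have h := (Measure.measurePreserving_homeomorphUnitSphereProd
    (volume : Measure (Amb d))).measure_preimage (hB.prod hm).nullMeasurableSet
  rw [comap_subtype_coe_apply (measurableSet_singleton _).compl, Measure.prod_prod,
    finrank_euclideanSpace_fin, Nat.add_sub_cancel, volumeIoiPow_shell _ hu] at h
  exact h

lemma le_shell_volume (d : ℕ) {u : ℝ} (hu : 0 ≤ u) : u ≤ ((1 + u) ^ (d + 1) - 1) / (d + 1) := by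
  rw [le_div_iff₀ (by positivity)]
  have := one_add_mul_le_pow (a := u) (by linarith) (d + 1)
  push_cast at this
  linarith

lemma shell_volume_le (d : ℕ) {u : ℝ} (hu : 0 ≤ u) (hu1 : u ≤ 1) :
    ((1 + u) ^ (d + 1) - 1) / (d + 1) ≤ 2 ^ d * u := by
  have key : ∀ n : ℕ, (1 + u) ^ n - 1 ≤ n * 2 ^ (n - 1) * u := by
    intro n
    induction n with
    | zero => simp
    | succ n ih =>
      have h2 : (1 + u) ^ n ≤ 2 ^ n := pow_le_pow_left₀ (by linarith) (by linarith) n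
      have h3 : (n : ℝ) * 2 ^ (n - 1) ≤ n * 2 ^ n := by
        gcongr
        · norm_num
        · omega
      rw [pow_succ]
      push_cast
      nlinarith
  have := key (d + 1)
  push_cast at this
  rw [div_le_iff₀ (by positivity)]
  linarith

/-- Spherical balls of radius `u` have surface measure of order `u ^ d`. -/
lemma surf_closedBall_bounds (d : ℕ) : ∃ c C : ℝ, 0 < c ∧ 0 < C ∧
    (∀ (θ : Sph d) (u : ℝ), 0 < u → surf d (Metric.closedBall θ u) ≤ ENNReal.ofReal (C * u ^ d)) ∧
    (∀ (θ : Sph d) (u : ℝ), 0 < u → u ≤ 1 →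
      ENNReal.ofReal (c * u ^ d) ≤ surf d (Metric.closedBall θ u)) := by
  set κ : ℝ := (volume : Measure (Amb d)).real (Metric.ball 0 1) with hκ
  have hκpos : 0 < κ := by
    rw [hκ, measureReal_def, ENNReal.toReal_pos_iff]
    exact ⟨Metric.measure_ball_pos _ _ one_pos, measure_ball_lt_top⟩
  have hball : ∀ (x : Amb d) (ρ : ℝ), 0 < ρ →
      (volume : Measure (Amb d)) (Metric.ball x ρ) = ENNReal.ofReal (κ * ρ ^ (d + 1)) := by
    intro x ρ hρ
    rw [Measure.addHaar_ball _ _ hρ.le, finrank_euclideanSpace_fin, hκ, measureReal_def, mul_comm,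
      ENNReal.ofReal_mul ENNReal.toReal_nonneg, ENNReal.ofReal_toReal measure_ball_lt_top.ne]
  have hmeas : ∀ (θ : Sph d) (u : ℝ), MeasurableSet (Metric.closedBall θ u) :=
    fun θ u => Metric.isClosed_closedBall.measurableSet
  have : IsFiniteMeasure (surf d) := by unfold surf; infer_instance
  set T : ℝ := (surf d).real univ
  -- The sector over a ball of radius `u ≤ 1` lies in a Euclidean ball of radius `3u` and contains
  -- one of radius `u/4`; `2 ^ d` comes from the shell volume, and `T` takes care of `u > 1`.
  refine ⟨κ / 4 ^ (d + 1) / 2 ^ d, κ * 3 ^ (d + 1) + T, by positivity, by positivity, ?_, ?_⟩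
  · intro θ u hu
    rcases le_or_gt u 1 with hu1 | hu1
    · have hsub : annularSector (Metric.closedBall θ u) u ⊆ Metric.ball (θ : Amb d) (3 * u) := by
        intro x hx
        obtain ⟨η, hη, t, h1, h2, rfl⟩ := mem_annularSector.1 hx
        have hη1 : ‖(η : Amb d)‖ = 1 := by simp
        rw [Metric.mem_ball]
        have e1 : dist (t • (η : Amb d)) η ≤ u := by
          rw [dist_eq_norm]
          have : t • (η : Amb d) - η = (t - 1) • (η : Amb d) := by rw [sub_smul, one_smul]
          rw [this, norm_smul, hη1, Real.norm_eq_abs, abs_of_nonneg (by linarith)]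
          linarith
        have e2 : dist (η : Amb d) θ ≤ u := hη
        linarith [dist_triangle (t • (η : Amb d)) η θ]
      have h := measure_mono (μ := (volume : Measure (Amb d))) hsub
      rw [volume_annularSector (hmeas _ _) hu.le, hball _ _ (by positivity)] at h
      have h2 : surf d (Metric.closedBall θ u) * ENNReal.ofReal u ≤
          ENNReal.ofReal (κ * 3 ^ (d + 1) * u ^ d) * ENNReal.ofReal u := by
        rw [← ENNReal.ofReal_mul (by positivity)]
        refine le_trans (by gcongr; exact le_shell_volume d hu.le) (h.trans (le_of_eq ?_))
        congr 1
        rw [mul_pow]; ring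
      rw [ENNReal.mul_le_mul_iff_left (by simpa using hu) ENNReal.ofReal_ne_top] at h2
      refine h2.trans (ENNReal.ofReal_le_ofReal ?_)
      gcongr
      have : 0 ≤ T := measureReal_nonneg
      linarith
    · calc surf d (Metric.closedBall θ u) ≤ surf d univ := measure_mono (subset_univ _)
        _ = ENNReal.ofReal T := (ofReal_measureReal).symm
        _ ≤ _ := by
          apply ENNReal.ofReal_le_ofReal
          have h1 : 1 ≤ u ^ d := one_le_pow₀ hu1.le
          have hT : 0 ≤ T := measureReal_nonneg
          have h3 : 0 ≤ κ * 3 ^ (d + 1) := by positivity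
          nlinarith
  · intro θ u hu hu1
    -- The centre is pushed out to radius `1 + u/4` so that the ball stays outside the unit ball.
    -- Projecting back to the sphere moves a point by at most `u/2`, which with two errors `u/4`
    -- gives `u`.
    have hsub : Metric.ball ((1 + u / 4) • (θ : Amb d)) (u / 4) ⊆
        annularSector (Metric.closedBall θ u) u := by
      intro x hx
      have hθ1 : ‖(θ : Amb d)‖ = 1 := by simp
      rw [Metric.mem_ball, dist_eq_norm] at hx
      have hc : ‖(1 + u / 4) • (θ : Amb d)‖ = 1 + u / 4 := by
        rw [norm_smul, hθ1, Real.norm_eq_abs, abs_of_pos (by linarith), mul_one]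
      have hab := (abs_le.1 ((abs_norm_sub_norm_le x ((1 + u / 4) • (θ : Amb d))).trans hx.le))
      rw [hc] at hab
      have hlow : 1 ≤ ‖x‖ := by linarith [hab.1]
      have hpos : 0 < ‖x‖ := by linarith
      have hup : ‖x‖ < 1 + u := by linarith [hab.2]
      have hmem : ‖x‖⁻¹ • x ∈ Metric.sphere (0 : Amb d) 1 := by
        simp [norm_smul, hpos.ne']
      refine mem_annularSector.2 ⟨⟨‖x‖⁻¹ • x, hmem⟩, ?_, ‖x‖, hlow, hup, ?_⟩
      · rw [Metric.mem_closedBall, Subtype.dist_eq, dist_eq_norm]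
        have e1 : ‖‖x‖⁻¹ • x - x‖ ≤ u / 2 := by
          have : ‖x‖⁻¹ • x - x = (‖x‖⁻¹ - 1) • x := by rw [sub_smul, one_smul]
          rw [this, norm_smul, Real.norm_eq_abs, abs_of_nonpos
            (by have := inv_le_one_of_one_le₀ hlow; linarith)]
          have : -(‖x‖⁻¹ - 1) * ‖x‖ = ‖x‖ - 1 := by field_simp; ring
          rw [this]; linarith [hab.2]
        have e2 : ‖(1 + u / 4) • (θ : Amb d) - θ‖ ≤ u / 4 := by
          have : (1 + u / 4) • (θ : Amb d) - θ = (u / 4) • (θ : Amb d) := by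
            rw [add_smul, one_smul]; abel
          rw [this, norm_smul, hθ1, Real.norm_eq_abs, abs_of_pos (by linarith), mul_one]
        have : ‖x‖⁻¹ • x - (θ : Amb d) = (‖x‖⁻¹ • x - x) + (x - (1 + u / 4) • (θ : Amb d)) +
          ((1 + u / 4) • (θ : Amb d) - θ) := by abel
        rw [this]
        refine (norm_add₃_le).trans ?_
        linarith
      · simp [smul_smul, hpos.ne']
    have h := measure_mono (μ := (volume : Measure (Amb d))) hsub
    rw [volume_annularSector (hmeas _ _) hu.le, hball _ _ (by positivity)] at h
    have h2 : ENNReal.ofReal (κ / 4 ^ (d + 1) / 2 ^ d * u ^ d) * ENNReal.ofReal (2 ^ d * u) ≤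
        surf d (Metric.closedBall θ u) * ENNReal.ofReal (2 ^ d * u) := by
      rw [← ENNReal.ofReal_mul (by positivity)]
      refine le_trans (le_of_eq ?_) (h.trans (by gcongr; exact shell_volume_le d hu.le hu1))
      congr 1
      rw [div_pow]
      field_simp
      ring
    rwa [ENNReal.mul_le_mul_iff_left (by simp; positivity) ENNReal.ofReal_ne_top] at h2

/-! ### Diameter, measure and number of the cells. -/

namespace DyadicDecomposition

lemma nonempty_cell {d : ℕ} (D : DyadicDecomposition d) {l m : ℕ} (hm : m < D.N l) :
    (D.cell l m).Nonempty := by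
  obtain ⟨c, C, hc, hC, h⟩ := D.squeezed
  obtain ⟨θ, h1, -⟩ := h l m hm
  refine ⟨θ, h1 ?_⟩
  have : angDist θ θ = 0 := by
    have := angDist_le_mul_dist θ θ
    rw [dist_self, mul_zero] at this
    exact le_antisymm this (InnerProductGeometry.angle_nonneg _ _)
  change angDist θ θ ≤ _
  rw [this]
  positivity

lemma exists_dist_le {d : ℕ} (D : DyadicDecomposition d) : ∃ R : ℝ, 0 < R ∧
    ∀ l, ∀ m < D.N l, ∀ x ∈ D.cell l m, ∀ y ∈ D.cell l m, dist x y ≤ R / 2 ^ l := by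
  obtain ⟨c, C, hc, hC, h⟩ := D.squeezed
  refine ⟨2 * C, by positivity, fun l m hm x hx y hy => ?_⟩
  obtain ⟨θ, -, h2⟩ := h l m hm
  have e : C * (2 : ℝ) ^ (-(l : ℤ)) = C / 2 ^ l := by
    rw [zpow_neg, zpow_natCast, div_eq_mul_inv]
  have e1 : dist x θ ≤ C / 2 ^ l := (dist_le_angDist x θ).trans (e ▸ h2 hx)
  have e2 : dist y θ ≤ C / 2 ^ l := (dist_le_angDist y θ).trans (e ▸ h2 hy)
  rw [mul_div_assoc]
  linarith [dist_triangle_right x y θ]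

lemma exists_surf_bounds {d : ℕ} (D : DyadicDecomposition d) : ∃ a A : ℝ, 0 < a ∧ 0 < A ∧
    ∀ l, ∀ m < D.N l, ENNReal.ofReal (a / (2 ^ l) ^ d) ≤ surf d (D.cell l m) ∧
      surf d (D.cell l m) ≤ ENNReal.ofReal (A / (2 ^ l) ^ d) := by
  obtain ⟨c, C, hc, hC, h⟩ := D.squeezed
  obtain ⟨a, A, ha, hA, hup, hlow⟩ := surf_closedBall_bounds d
  -- Halving `c` fits a chordal ball into the angular cap; the minimum with 1 keeps its radius in
  -- the range of the lower ball estimate.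
  refine ⟨a * (min (c / 2) 1) ^ d, A * C ^ d, by positivity, by positivity, fun l m hm => ?_⟩
  obtain ⟨θ, h1, h2⟩ := h l m hm
  have e : ∀ x : ℝ, x * (2 : ℝ) ^ (-(l : ℤ)) = x / 2 ^ l := fun x => by
    rw [zpow_neg, zpow_natCast, div_eq_mul_inv]
  rw [e] at h1 h2
  constructor
  · have hr : min (c / 2) 1 / 2 ^ l ≤ 1 :=
      div_le_one_of_le₀ ((min_le_right _ _).trans (one_le_pow₀ one_le_two)) (by positivity)
    have := hlow θ (min (c / 2) 1 / 2 ^ l) (by positivity) hr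
    rw [div_pow, ← mul_div_assoc] at this
    refine this.trans (measure_mono (Subset.trans (fun η hη => ?_) h1))
    have h3 : dist η θ ≤ min (c / 2) 1 / 2 ^ l := hη
    have h4 : min (c / 2) 1 / 2 ^ l ≤ c / 2 / 2 ^ l := by gcongr; exact min_le_left _ _
    have h5 := angDist_le_mul_dist η θ
    change angDist η θ ≤ _
    calc angDist η θ ≤ 2 * (c / 2 / 2 ^ l) := by linarith
      _ = c / 2 ^ l := by ring
  · have := hup θ (C / 2 ^ l) (by positivity)
    rw [div_pow, ← mul_div_assoc] at this
    exact (measure_mono (Subset.trans h2 fun η hη => (dist_le_angDist η θ).trans hη)).trans this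

lemma sum_surf_cell {d : ℕ} (D : DyadicDecomposition d) (l : ℕ) :
    ∑ m ∈ Finset.range (D.N l), surf d (D.cell l m) = surf d univ := by
  rw [← measure_biUnion_finset]
  · congr 1
    refine eq_univ_of_forall fun θ => ?_
    obtain ⟨m, hm, hθ⟩ := D.cover l θ
    exact mem_biUnion (Finset.mem_coe.2 (Finset.mem_range.2 hm)) hθ
  · intro m hm m' hm' hne
    exact D.disjoint l m (Finset.mem_range.1 hm) m' (Finset.mem_range.1 hm') hne
  · exact fun m hm => D.measurableSet_cell l m (Finset.mem_range.1 hm)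

instance isFiniteMeasure_surf (d : ℕ) : IsFiniteMeasure (surf d) := by
  unfold surf; infer_instance

lemma surf_real_univ_pos (d : ℕ) : 0 < (surf d).real univ := by
  rw [measureReal_def, ENNReal.toReal_pos_iff]
  refine ⟨?_, measure_lt_top _ _⟩
  rw [pos_iff_ne_zero, Measure.measure_univ_ne_zero]
  exact Measure.toSphere_ne_zero _

/-- The cells share the fixed total measure of the sphere and each has measure of order `2^(-ld)`.
-/
lemma exists_card_bounds {d : ℕ} (D : DyadicDecomposition d) : ∃ a A : ℝ, 0 < a ∧ 0 < A ∧
    ∀ l, a * (2 ^ l) ^ d ≤ D.N l ∧ (D.N l : ℝ) ≤ A * (2 ^ l) ^ d := by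
  obtain ⟨a, A, ha, hA, h⟩ := D.exists_surf_bounds
  set T := (surf d).real univ
  have hT : 0 < T := surf_real_univ_pos d
  refine ⟨T / A, T / a, by positivity, by positivity, fun l => ?_⟩
  have hTsum : ENNReal.ofReal T = ∑ m ∈ Finset.range (D.N l), surf d (D.cell l m) := by
    rw [sum_surf_cell]; exact ofReal_measureReal
  constructor
  · have h1 : ENNReal.ofReal T ≤ ENNReal.ofReal (D.N l * (A / (2 ^ l) ^ d)) := by
      rw [hTsum, ENNReal.ofReal_mul (by positivity), ENNReal.ofReal_natCast]
      refine (Finset.sum_le_card_nsmul _ _ _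
        fun m hm => (h l m (Finset.mem_range.1 hm)).2).trans (by simp)
    rw [ENNReal.ofReal_le_ofReal_iff (by positivity)] at h1
    rw [div_mul_eq_mul_div, div_le_iff₀ hA]
    rw [mul_div_assoc', le_div_iff₀ (by positivity)] at h1
    exact h1
  · have h1 : ENNReal.ofReal (D.N l * (a / (2 ^ l) ^ d)) ≤ ENNReal.ofReal T := by
      rw [hTsum, ENNReal.ofReal_mul (by positivity), ENNReal.ofReal_natCast]
      refine le_trans (by simp) (Finset.card_nsmul_le_sum _ _ _
        fun m hm => (h l m (Finset.mem_range.1 hm)).1)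
    rw [ENNReal.ofReal_le_ofReal_iff hT.le] at h1
    rw [div_mul_eq_mul_div, le_div_iff₀ ha]
    rw [mul_div_assoc', div_le_iff₀ (by positivity)] at h1
    exact h1

end DyadicDecomposition

end Geometry

/-! ### From integer moments of approximations to real moments of the limit. -/

section AbstractMoments

lemma ENNReal.rpow_le_one_add_pow {x : ℝ≥0∞} {q : ℝ} {p : ℕ} (hq : 0 ≤ q) (hqp : q ≤ p) :
    x ^ q ≤ 1 + x ^ p := by
  rcases le_total x 1 with h | h
  · exact (ENNReal.rpow_le_one h hq).trans le_self_add
  · rw [← ENNReal.rpow_natCast]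
    exact (ENNReal.rpow_le_rpow_of_exponent_le h hqp).trans le_add_self

/-- Truncation at `M` loses little mass once second moments are bounded. -/
lemma ENNReal.le_min_add_div {x M : ℝ≥0∞} (hM0 : M ≠ 0) (hM : M ≠ ∞) :
    x ≤ min x M + M⁻¹ * x ^ 2 := by
  rcases le_total x M with h | h
  · rw [min_eq_left h]; exact le_self_add
  · refine le_trans ?_ le_add_self
    calc x = M⁻¹ * (M * x) := by rw [← mul_assoc, ENNReal.inv_mul_cancel hM0 hM, one_mul]
      _ ≤ M⁻¹ * x ^ 2 := by rw [sq]; gcongr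

/-- If `Z n → Z` almost surely, the first moments of `Z n` are bounded below, and their `p`-th
moments are bounded above, then `E Z ^ q` is bounded on both sides for `q ∈ [0, p]`. -/
lemma lintegral_rpow_bounds {Ω : Type*} [MeasurableSpace Ω] (Q : Measure Ω)
    [IsProbabilityMeasure Q] {Z : ℕ → Ω → ℝ≥0∞} {Z' : Ω → ℝ≥0∞} (hZ : ∀ n, Measurable (Z n))
    (hZ' : Measurable Z') (hlim : ∀ᵐ ω ∂Q, Tendsto (fun n => Z n ω) atTop (𝓝 (Z' ω)))
    {c C q : ℝ} {p : ℕ} (hc : 0 < c) (hC : 0 < C) (hp : 2 ≤ p) (hq : 0 ≤ q) (hqp : q ≤ p)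
    (hlow : ∀ᶠ n in atTop, ENNReal.ofReal c ≤ ∫⁻ ω, Z n ω ∂Q)
    (hup : ∀ᶠ n in atTop, ∫⁻ ω, Z n ω ^ p ∂Q ≤ ENNReal.ofReal C) :
    ENNReal.ofReal ((c / 4) ^ q * (c ^ 2 / (8 * (1 + C)))) ≤ ∫⁻ ω, Z' ω ^ q ∂Q ∧
      ∫⁻ ω, Z' ω ^ q ∂Q ≤ ENNReal.ofReal (1 + C) := by
  constructor
  -- The level at which the truncation error `(1 + C) / M` equals `c / 2`.
  · set M : ℝ := 2 * (1 + C) / c with hMdef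
    have hMpos : 0 < M := by positivity
    have hsq : ∀ᶠ n in atTop, ENNReal.ofReal (c / 2) ≤ ∫⁻ ω, min (Z n ω) (ENNReal.ofReal M) ∂Q := by
      filter_upwards [hlow, hup] with n h1 h2
      have h3 : ∫⁻ ω, Z n ω ^ 2 ∂Q ≤ ENNReal.ofReal (1 + C) := by
        calc ∫⁻ ω, Z n ω ^ 2 ∂Q ≤ ∫⁻ ω, (1 + Z n ω ^ p) ∂Q := by
              refine lintegral_mono fun ω => ?_
              have := ENNReal.rpow_le_one_add_pow (x := Z n ω) (q := 2) (p := p) (by norm_num)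
                (by exact_mod_cast hp)
              exact_mod_cast this
          _ = 1 + ∫⁻ ω, Z n ω ^ p ∂Q := by
              rw [lintegral_add_left measurable_const]; simp
          _ ≤ 1 + ENNReal.ofReal C := by gcongr
          _ = ENNReal.ofReal (1 + C) := by rw [ENNReal.ofReal_add zero_le_one hC.le]; simp
      have h4 : ENNReal.ofReal c ≤ ∫⁻ ω, min (Z n ω) (ENNReal.ofReal M) ∂Q +
          ENNReal.ofReal (c / 2) := by
        calc ENNReal.ofReal c ≤ ∫⁻ ω, Z n ω ∂Q := h1
          _ ≤ ∫⁻ ω, (min (Z n ω) (ENNReal.ofReal M) + (ENNReal.ofReal M)⁻¹ * Z n ω ^ 2) ∂Q :=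
              lintegral_mono fun ω => ENNReal.le_min_add_div (by simpa using hMpos)
                ENNReal.ofReal_ne_top
          _ = ∫⁻ ω, min (Z n ω) (ENNReal.ofReal M) ∂Q +
                (ENNReal.ofReal M)⁻¹ * ∫⁻ ω, Z n ω ^ 2 ∂Q := by
              rw [lintegral_add_left ((hZ n).min measurable_const),
                lintegral_const_mul _ ((hZ n).pow_const 2)]
          _ ≤ ∫⁻ ω, min (Z n ω) (ENNReal.ofReal M) ∂Q +
                (ENNReal.ofReal M)⁻¹ * ENNReal.ofReal (1 + C) := by gcongr
          _ = _ := by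
              rw [← ENNReal.ofReal_inv_of_pos hMpos, ← ENNReal.ofReal_mul (by positivity)]
              congr 2
              rw [hMdef]; field_simp
      have h5 : ENNReal.ofReal c = ENNReal.ofReal (c / 2) + ENNReal.ofReal (c / 2) := by
        rw [← ENNReal.ofReal_add (by positivity) (by positivity), add_halves]
      rw [h5] at h4
      exact (ENNReal.add_le_add_iff_right ENNReal.ofReal_ne_top).1 h4
    -- The truncated variables are bounded, so dominated convergence carries the lower bound to the
    -- limit.
    have hmin : ENNReal.ofReal (c / 2) ≤ ∫⁻ ω, min (Z' ω) (ENNReal.ofReal M) ∂Q := by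
      refine ge_of_tendsto (tendsto_lintegral_of_dominated_convergence
        (fun _ => ENNReal.ofReal M) (fun n => (hZ n).min measurable_const)
        (fun n => ae_of_all _ fun ω => min_le_right _ _) (by simp) ?_) hsq
      filter_upwards [hlim] with ω hω
      exact hω.min tendsto_const_nhds
    -- A Paley–Zygmund argument: off `S` the truncated mean collects at most `c / 4`, and on `S` at
    -- most `M * Q S`, so `S` has probability at least `c / (4 * M)`.
    set S : Set Ω := {ω | ENNReal.ofReal (c / 4) ≤ Z' ω} with hS
    have hSm : MeasurableSet S := measurableSet_le measurable_const hZ'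
    have hQS : ENNReal.ofReal (c / 4) ≤ ENNReal.ofReal M * Q S := by
      have : ENNReal.ofReal (c / 2) ≤ ENNReal.ofReal (c / 4) + ENNReal.ofReal M * Q S := by
        calc _ ≤ ∫⁻ ω, min (Z' ω) (ENNReal.ofReal M) ∂Q := hmin
          _ ≤ ∫⁻ ω, (ENNReal.ofReal (c / 4) + S.indicator (fun _ => ENNReal.ofReal M) ω) ∂Q := by
              refine lintegral_mono fun ω => ?_
              by_cases hω : ω ∈ S
              · rw [indicator_of_mem hω]
                exact (min_le_right _ _).trans le_add_self
              · have : Z' ω < ENNReal.ofReal (c / 4) := not_le.1 hω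
                exact (min_le_left _ _).trans (this.le.trans le_self_add)
          _ = _ := by
              rw [lintegral_add_left measurable_const, lintegral_indicator_const hSm]; simp
      have h5 : ENNReal.ofReal (c / 2) = ENNReal.ofReal (c / 4) + ENNReal.ofReal (c / 4) := by
        rw [← ENNReal.ofReal_add (by positivity) (by positivity)]; congr 1; ring
      rw [h5] at this
      exact (ENNReal.add_le_add_iff_left ENNReal.ofReal_ne_top).1 this
    have hQS' : ENNReal.ofReal (c ^ 2 / (8 * (1 + C))) ≤ Q S := by
      have h1 : ENNReal.ofReal M * ENNReal.ofReal (c ^ 2 / (8 * (1 + C))) ≤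
          ENNReal.ofReal M * Q S := by
        refine le_trans (le_of_eq ?_) hQS
        rw [← ENNReal.ofReal_mul hMpos.le]
        congr 1
        rw [hMdef]; field_simp; ring
      rwa [ENNReal.mul_le_mul_iff_right (by simpa using hMpos) ENNReal.ofReal_ne_top] at h1
    calc ENNReal.ofReal ((c / 4) ^ q * (c ^ 2 / (8 * (1 + C))))
        = ENNReal.ofReal (c / 4) ^ q * ENNReal.ofReal (c ^ 2 / (8 * (1 + C))) := by
          rw [ENNReal.ofReal_mul (by positivity), ENNReal.ofReal_rpow_of_nonneg (by positivity) hq]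
      _ ≤ ENNReal.ofReal (c / 4) ^ q * Q S := by gcongr
      _ = ∫⁻ _ in S, ENNReal.ofReal (c / 4) ^ q ∂Q := by rw [setLIntegral_const]
      _ ≤ ∫⁻ ω in S, Z' ω ^ q ∂Q :=
          setLIntegral_mono (hZ'.pow_const q) fun ω hω => ENNReal.rpow_le_rpow hω hq
      _ ≤ _ := setLIntegral_le_lintegral _ _
  -- Fatou's lemma suffices for the upper bound.
  · have h1 : ∫⁻ ω, Z' ω ^ p ∂Q ≤ ENNReal.ofReal C := by
      calc ∫⁻ ω, Z' ω ^ p ∂Q = ∫⁻ ω, liminf (fun n => Z n ω ^ p) atTop ∂Q := by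
            refine lintegral_congr_ae ?_
            filter_upwards [hlim] with ω hω
            exact (((ENNReal.continuous_pow p).tendsto _).comp hω).liminf_eq.symm
        _ ≤ liminf (fun n => ∫⁻ ω, Z n ω ^ p ∂Q) atTop :=
            lintegral_liminf_le fun n => (hZ n).pow_const p
        _ ≤ liminf (fun _ : ℕ => ENNReal.ofReal C) atTop := liminf_le_liminf hup
        _ = _ := by simp
    calc ∫⁻ ω, Z' ω ^ q ∂Q ≤ ∫⁻ ω, (1 + Z' ω ^ p) ∂Q :=
          lintegral_mono fun ω => ENNReal.rpow_le_one_add_pow hq hqp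
      _ = 1 + ∫⁻ ω, Z' ω ^ p ∂Q := by rw [lintegral_add_left measurable_const]; simp
      _ ≤ 1 + ENNReal.ofReal C := by gcongr
      _ = _ := by rw [ENNReal.ofReal_add zero_le_one hC.le]; simp

end AbstractMoments

/-! ### Exponential moments of the Gaussian fields. -/

section GaussianMoments

variable {Ω : Type*} [MeasurableSpace Ω] {P : Measure Ω} {d : ℕ} {b s : ℝ} {r : ℝ → ℝ}
  {X : ℕ → Amb d → Ω → ℝ}

namespace IsGeomGaussianModel

/-- A linear combination of values of a centred Gaussian process is a centred Gaussian variable, so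
its moment generating function at 1 is the exponential of half its variance. -/
lemma integral_exp_sum (hX : IsGeomGaussianModel P b s r X) {ι : Type*} [Fintype ι] (i : ℕ)
    (c : ι → ℝ) (u : ι → Amb d) :
    Integrable (fun ω => Real.exp (∑ a, c a * X i (u a) ω)) P ∧
    ∫ ω, Real.exp (∑ a, c a * X i (u a) ω) ∂P =
      Real.exp ((∑ a, ∑ a', c a * c a' * r ‖u a - u a'‖) / 2) := by
  have hP : IsProbabilityMeasure P := (hX.gaussian i).isProbabilityMeasure
  have hl2 : ∀ v, MemLp (X i v) 2 P := fun v => ((hX.gaussian i).hasGaussianLaw_eval v).memLp_two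
  have hG : HasGaussianLaw (fun ω => ∑ a, c a * X i (u a) ω) P :=
    (((hX.gaussian i).comp_right u).smul c).hasGaussianLaw_fun_sum (I := Finset.univ)
  have hmean : ∫ ω, ∑ a, c a * X i (u a) ω ∂P = 0 := by
    rw [integral_finsetSum _ fun a _ => ((hl2 (u a)).integrable one_le_two).const_mul _]
    simp [integral_const_mul, hX.mean]
  have hvar : Var[fun ω => ∑ a, c a * X i (u a) ω; P] =
      ∑ a, ∑ a', c a * c a' * r ‖u a - u a'‖ := by
    rw [variance_of_integral_eq_zero hG.aemeasurable hmean]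
    have e : ∀ ω, (∑ a, c a * X i (u a) ω) ^ 2 =
        ∑ a, ∑ a', c a * c a' * (X i (u a) ω * X i (u a') ω) := fun ω => by
      rw [sq, Finset.sum_mul_sum]
      exact Finset.sum_congr rfl fun a _ => Finset.sum_congr rfl fun a' _ => by ring
    have hi : ∀ a a', Integrable (fun ω => c a * c a' * (X i (u a) ω * X i (u a') ω)) P :=
      fun a a' => ((hl2 (u a)).integrable_mul (hl2 (u a'))).const_mul _
    simp_rw [e]
    rw [integral_finsetSum _ fun a _ => integrable_finsetSum _ fun a' _ => hi a a']
    refine Finset.sum_congr rfl fun a _ => ?_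
    rw [integral_finsetSum _ fun a' _ => hi a a']
    refine Finset.sum_congr rfl fun a' _ => ?_
    rw [integral_const_mul, hX.covariance]
  have hlaw := hG.map_eq_gaussianReal
  constructor
  · have h1 := integrable_exp_mul_gaussianReal (μ := P[fun ω => ∑ a, c a * X i (u a) ω])
      (v := Var[fun ω => ∑ a, c a * X i (u a) ω; P].toNNReal) 1
    rw [← hlaw] at h1
    have h2 := h1.comp_aemeasurable hG.aemeasurable
    simpa [Function.comp_def] using h2
  · have h1 := mgf_gaussianReal hlaw 1
    rw [hmean, mgf, Real.coe_toNNReal _ (variance_nonneg _ _), hvar] at h1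
    simpa using h1

lemma r_zero (hX : IsGeomGaussianModel P b s r X) : r 0 = s ^ 2 := by
  have h := hX.covariance 0 0 0
  rw [sub_self, norm_zero] at h
  rw [← h, ← hX.variance 0 0]
  simp_rw [sq]

lemma geomField_eq (hX : IsGeomGaussianModel P b s r X) (i : ℕ) (θ : Sph d) (ω : Ω) :
    geomField P b X i θ ω = Real.exp (X i (b ^ i • (θ : Amb d)) ω - s ^ 2 / 2) := by
  have h := (hX.integral_exp_sum i (fun _ : Unit => 1) (fun _ => b ^ i • (θ : Amb d))).2
  simp only [one_mul, Finset.univ_unique, Finset.sum_const, Finset.card_singleton, one_smul,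
    sub_self, norm_zero, hX.r_zero] at h
  rw [geomField, h, Real.exp_sub]

lemma geomField_pos (hX : IsGeomGaussianModel P b s r X) (i : ℕ) (θ : Sph d) (ω : Ω) :
    0 < geomField P b X i θ ω := by
  rw [hX.geomField_eq]; exact Real.exp_pos _

lemma measurable_geomField (hX : IsGeomGaussianModel P b s r X) (i : ℕ) (θ : Sph d) :
    Measurable (geomField P b X i θ) :=
  (hX.measurable_sphere i).comp measurable_prodMk_left

/-- Joint moments of the fields at finitely many points of the sphere. -/
lemma lintegral_prod_geomField (hX : IsGeomGaussianModel P b s r X) {ι : Type*} [Fintype ι]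
    (M : ℕ) (c : ℕ → ι → ℝ) (θ : ι → Sph d) :
    ∫⁻ ω, ∏ i ∈ Finset.range M, ENNReal.ofReal (∏ a, geomField P b X i (θ a) ω ^ c i a) ∂P =
      ENNReal.ofReal (Real.exp (∑ i ∈ Finset.range M,
        ((∑ a, ∑ a', c i a * c i a' * r (‖b ^ i‖ * dist (θ a) (θ a'))) / 2 -
          s ^ 2 / 2 * ∑ a, c i a))) := by
  have hP : IsProbabilityMeasure P := (hX.gaussian 0).isProbabilityMeasure
  obtain ⟨f, hfdef⟩ : ∃ f : ℕ → (Amb d → ℝ) → ℝ≥0∞, f = fun i x =>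
    ENNReal.ofReal (Real.exp (∑ a, c i a * (x (b ^ i • (θ a : Amb d)) - s ^ 2 / 2))) := ⟨_, rfl⟩
  have hf : ∀ i, Measurable (f i) := by
    intro i
    rw [hfdef]
    refine ENNReal.measurable_ofReal.comp (Real.measurable_exp.comp ?_)
    exact Finset.measurable_sum _ fun a _ => ((measurable_pi_apply _).sub_const _).const_mul _
  have he : ∀ i ω, ENNReal.ofReal (∏ a, geomField P b X i (θ a) ω ^ c i a) =
      f i (fun u => X i u ω) := by
    intro i ω
    simp only [hfdef]
    congr 1
    rw [Real.exp_sum]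
    refine Finset.prod_congr rfl fun a _ => ?_
    rw [hX.geomField_eq, ← Real.exp_mul, mul_comm]
  have hm : ∀ i, Measurable fun ω => fun u => X i u ω := fun i =>
    measurable_pi_lambda _ fun u => hX.measurable i u
  simp_rw [he]
  -- Each factor is a measurable function of one whole field, so independence of the fields
  -- factorizes the expectation.
  rw [lintegral_prod_eq_prod_lintegral_of_indepFun _ (fun i ω => f i (fun u => X i u ω))
    (hX.indep.comp f hf) fun i => (hf i).comp (hm i), Real.exp_sum,
    ENNReal.ofReal_prod_of_nonneg fun _ _ => (Real.exp_pos _).le]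
  refine Finset.prod_congr rfl fun i _ => ?_
  obtain ⟨hint, hval⟩ := hX.integral_exp_sum i (c i) (fun a => b ^ i • (θ a : Amb d))
  have e : ∀ ω, Real.exp (∑ a, c i a * (X i (b ^ i • (θ a : Amb d)) ω - s ^ 2 / 2)) =
      Real.exp (-(s ^ 2 / 2 * ∑ a, c i a)) *
        Real.exp (∑ a, c i a * X i (b ^ i • (θ a : Amb d)) ω) := by
    intro ω
    rw [← Real.exp_add]
    congr 1
    simp_rw [mul_sub, Finset.sum_sub_distrib, ← Finset.sum_mul]
    ring
  simp only [hfdef]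
  simp_rw [e]
  rw [← ofReal_integral_eq_lintegral_ofReal (hint.const_mul _)
    (ae_of_all _ fun ω => by positivity), integral_const_mul, hval, ← Real.exp_add]
  congr 2
  simp_rw [← smul_sub, norm_smul, Subtype.dist_eq, dist_eq_norm]
  ring

end IsGeomGaussianModel

end GaussianMoments

/-! ### The multiscale pair kernel and its integrability. -/

section Kernel

lemma nonneg_of_antitoneOn_of_summable {r : ℝ → ℝ} {b : ℝ} (hr : AntitoneOn r (Ici 0)) (hb : 1 < b)
    (hsum : Summable fun i : ℕ => r (b ^ i)) {t : ℝ} (ht : 0 ≤ t) : 0 ≤ r t := by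
  refine le_of_tendsto hsum.tendsto_atTop_zero ?_
  filter_upwards [(tendsto_pow_atTop_atTop_of_one_lt hb).eventually_ge_atTop t] with i hi
  exact hr ht (ht.trans hi) hi

/-- Each frequency with `b ^ j * t < 1` costs at most a factor `exp (M * r 0)`, while the others
together cost a bounded factor since `r (b ^ i)` is summable. Summing over `k`, instead of keeping
only the largest power, yields indicators of balls that can be integrated one by one. -/
lemma exp_sum_kernel_le {r : ℝ → ℝ} {b M : ℝ} (hr : AntitoneOn r (Ici 0)) (hb : 1 < b)
    (hsum : Summable fun i : ℕ => r (b ^ i)) (hM : 0 ≤ M) (L : ℕ) (t : ℝ) (ht : 0 ≤ t) :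
    Real.exp (M * ∑ j ∈ Finset.range L, r (b ^ j * t)) ≤
      Real.exp (M * ∑' i : ℕ, r (b ^ i)) *
        (1 + ∑ k ∈ Finset.range L, if b ^ k * t < 1 then Real.exp (M * r 0) ^ (k + 1) else 0) := by
  have hnn : ∀ t, 0 ≤ t → 0 ≤ r t := fun t ht => nonneg_of_antitoneOn_of_summable hr hb hsum ht
  have hb0 : 0 < b := by linarith
  induction L generalizing t with
  | zero =>
    simp only [Finset.range_zero, Finset.sum_empty, mul_zero, Real.exp_zero, add_zero, mul_one]
    exact Real.one_le_exp (mul_nonneg hM (tsum_nonneg fun i => hnn _ (by positivity)))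
  | succ L ih =>
    rcases le_or_gt 1 t with h1 | h1
    · refine le_trans (Real.exp_le_exp.2 (mul_le_mul_of_nonneg_left ?_ hM))
        (le_mul_of_one_le_right (Real.exp_pos _).le (le_add_of_nonneg_right
          (Finset.sum_nonneg fun k _ => by split_ifs <;> positivity)))
      refine (Finset.sum_le_sum fun j _ => ?_).trans
        (hsum.sum_le_tsum (Finset.range (L + 1)) fun i _ => hnn _ (by positivity))
      exact hr (mem_Ici.2 (by positivity)) (mem_Ici.2 (by positivity))
        (le_mul_of_one_le_right (by positivity) h1)
    -- The frequency `j = 0` is split off; the rest is the same sum at the rescaled distance `b *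
    -- t`.
    · have h := ih (b * t) (by positivity)
      have e1 : ∀ j : ℕ, b ^ (j + 1) * t = b ^ j * (b * t) := fun j => by ring
      rw [Finset.sum_range_succ', Finset.sum_range_succ' (fun k => if b ^ k * t < 1 then
        Real.exp (M * r 0) ^ (k + 1) else 0)]
      simp_rw [e1]
      simp only [pow_zero, one_mul, if_pos h1, zero_add, pow_one]
      set S := ∑ k ∈ Finset.range L, if b ^ k * (b * t) < 1 then
        Real.exp (M * r 0) ^ (k + 1) else 0
      have e2 : (∑ k ∈ Finset.range L, if b ^ k * (b * t) < 1 then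
          Real.exp (M * r 0) ^ (k + 1 + 1) else 0) = S * Real.exp (M * r 0) := by
        rw [Finset.sum_mul]
        refine Finset.sum_congr rfl fun k _ => ?_
        split_ifs
        · rw [pow_succ]
        · rw [zero_mul]
      rw [e2, mul_add, Real.exp_add]
      have h3 : Real.exp (M * r t) ≤ Real.exp (M * r 0) :=
        Real.exp_le_exp.2 (mul_le_mul_of_nonneg_left
          (hr (mem_Ici.2 le_rfl) (mem_Ici.2 ht) ht) hM)
      calc _ ≤ (Real.exp (M * ∑' i : ℕ, r (b ^ i)) * (1 + S)) * Real.exp (M * r 0) := by gcongr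
        _ = Real.exp (M * ∑' i : ℕ, r (b ^ i)) *
            (S * Real.exp (M * r 0) + Real.exp (M * r 0)) := by ring
        _ ≤ _ := mul_le_mul_of_nonneg_left (by linarith) (Real.exp_pos _).le

/-- The exponential of a sum over pairs is controlled by single pairs. -/
lemma exp_half_sum_offDiag_le {p : ℕ} (hp : 2 ≤ p) (G : Fin p → Fin p → ℝ) :
    Real.exp ((∑ x ∈ Finset.univ.offDiag, G x.1 x.2) / 2) ≤
      ∑ x ∈ (Finset.univ : Finset (Fin p)).offDiag,
        Real.exp ((p : ℝ) * (p - 1) / 2 * G x.1 x.2) := by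
  set S := (Finset.univ : Finset (Fin p)).offDiag
  have hne : S.Nonempty := ⟨(⟨0, by omega⟩, ⟨1, by omega⟩), by simp [S]⟩
  -- The largest pair dominates the average over all `p * (p - 1)` ordered pairs; the factor
  -- `p(p-1)/2` in the hypothesis on `b` originates here.
  obtain ⟨x, hx, hmax⟩ := S.exists_max_image (fun x => G x.1 x.2) hne
  have hcard : (S.card : ℝ) = (p : ℝ) * (p - 1) := by
    simp only [S, Finset.offDiag_card, Finset.card_univ, Fintype.card_fin]
    rw [Nat.cast_sub (by nlinarith)]
    push_cast; ring
  have h1 : ∑ x ∈ S, G x.1 x.2 ≤ (p : ℝ) * (p - 1) * G x.1 x.2 := by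
    rw [← hcard, ← nsmul_eq_mul]
    exact Finset.sum_le_card_nsmul _ _ _ hmax
  refine le_trans (Real.exp_le_exp.2 ?_) (Finset.single_le_sum
    (f := fun x : Fin p × Fin p => Real.exp ((p : ℝ) * (p - 1) / 2 * G x.1 x.2))
    (fun _ _ => (Real.exp_pos _).le) hx)
  linarith

/-- Two distinct coordinates have joint law `ν.prod ν`, so a bound uniform in one variable is
enough. -/
lemma lintegral_pi_pair_le {S : Type*} [MeasurableSpace S] (ν : Measure S) [IsProbabilityMeasure ν]
    {p : ℕ} {a a' : Fin p} (ha : a ≠ a') {f : S × S → ℝ≥0∞} (hf : Measurable f) {K : ℝ≥0∞}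
    (hK : ∀ x, ∫⁻ y, f (x, y) ∂ν ≤ K) :
    ∫⁻ x, f (x a, x a') ∂(Measure.pi fun _ : Fin p => ν) ≤ K := by
  have hind : iIndepFun (fun (i : Fin p) (x : Fin p → S) => x i)
      (Measure.pi fun _ : Fin p => ν) :=
    iIndepFun_pi (X := fun (_ : Fin p) (x : S) => x) fun i => aemeasurable_id
  have hmap := (indepFun_iff_map_prod_eq_prod_map_map (measurable_pi_apply a).aemeasurable
    (measurable_pi_apply a').aemeasurable).1 (hind.indepFun ha)
  have he : ∀ i : Fin p, (Measure.pi fun _ : Fin p => ν).map (fun x => x i) = ν :=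
    fun i => (measurePreserving_eval (fun _ : Fin p => ν) i).map_eq
  rw [he, he] at hmap
  rw [← lintegral_map (f := f) (g := fun x : Fin p → S => (x a, x a')) hf
    ((measurable_pi_apply a).prodMk (measurable_pi_apply a')), hmap, lintegral_prod _ hf.aemeasurable]
  calc _ ≤ ∫⁻ _, K ∂ν := lintegral_mono hK
    _ = K := by simp

lemma pow_lintegral_eq_lintegral_pi {S : Type*} [MeasurableSpace S] (ν : Measure S)
    [IsProbabilityMeasure ν] (k : ℕ) {f : S → ℝ≥0∞} (hf : Measurable f) :
    (∫⁻ x, f x ∂ν) ^ k = ∫⁻ x, ∏ j, f (x j) ∂(Measure.pi fun _ : Fin k => ν) := by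
  have hind : iIndepFun (fun (i : Fin k) (x : Fin k → S) => f (x i))
      (Measure.pi fun _ : Fin k => ν) :=
    iIndepFun_pi (X := fun (_ : Fin k) (x : S) => f x) fun i => hf.aemeasurable
  rw [lintegral_prod_eq_prod_lintegral_of_indepFun _ _ hind
    fun i => hf.comp (measurable_pi_apply i)]
  have he : ∀ i : Fin k, ∫⁻ x, f (x i) ∂(Measure.pi fun _ : Fin k => ν) = ∫⁻ x, f x ∂ν := fun i =>
    (measurePreserving_eval (fun _ : Fin k => ν) i).lintegral_comp hf
  simp [he]

/-- The singular kernel has a bounded integral against the normalized surface measure of a set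
whose surface measure is at least of order `b ^ (-n d)`. -/
lemma exists_lintegral_kernel_le (d : ℕ) {b g a K₀ : ℝ} (hb : 1 < b) (hg : 0 < g) (ha : 0 < a)
    (hgb : g < b ^ d) (hK₀ : 0 < K₀) : ∃ K : ℝ, 0 < K ∧ ∀ (A : Set (Sph d)) (n l L : ℕ),
      ENNReal.ofReal (a / (2 ^ l) ^ d) ≤ surf d A → (2 : ℝ) ^ l < b ^ (n + 1) →
      ∀ θ : Sph d, ∫⁻ η, ENNReal.ofReal (K₀ * (1 + ∑ k ∈ Finset.range L,
        if b ^ k * (b ^ n * dist θ η) < 1 then g ^ (k + 1) else 0)) ∂((surf d)[|A]) ≤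
          ENNReal.ofReal K := by
  obtain ⟨-, C, -, hC, hup, -⟩ := surf_closedBall_bounds d
  have hb0 : 0 < b := by linarith
  -- Ratio of the geometric series: the kernel gains `g` per scale and the measure of the ball loses
  -- `b ^ d`.
  set ρ : ℝ := g / b ^ d
  have hρ0 : 0 < ρ := by positivity
  have hρ1 : ρ < 1 := (div_lt_one (by positivity)).2 hgb
  have h1ρ : 0 < 1 - ρ := by linarith
  refine ⟨K₀ * (1 + g * (C / a * b ^ d) * (1 - ρ)⁻¹), by positivity, ?_⟩
  intro A n l L hA hl θ
  have hA0 : surf d A ≠ 0 := by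
    intro h0
    rw [h0, nonpos_iff_eq_zero, ENNReal.ofReal_eq_zero] at hA
    exact absurd hA (not_le.2 (by positivity))
  have : IsProbabilityMeasure ((surf d)[|A]) := cond_isProbabilityMeasure hA0
  have hball : ∀ k : ℕ, (surf d)[|A] {η | b ^ k * (b ^ n * dist θ η) < 1} ≤
      ENNReal.ofReal (C / a * b ^ d * (1 / b ^ d) ^ k) := by
    intro k
    have hsub : {η | b ^ k * (b ^ n * dist θ η) < 1} ⊆
        Metric.closedBall θ (1 / (b ^ k * b ^ n)) := by
      intro η hη
      rw [Metric.mem_closedBall, dist_comm, le_div_iff₀ (by positivity)]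
      have : b ^ k * (b ^ n * dist θ η) < 1 := hη
      linarith
    calc (surf d)[|A] {η | b ^ k * (b ^ n * dist θ η) < 1}
        ≤ (surf d)[|A] (Metric.closedBall θ (1 / (b ^ k * b ^ n))) := measure_mono hsub
      _ ≤ (surf d A)⁻¹ * surf d (Metric.closedBall θ (1 / (b ^ k * b ^ n))) := by
          rw [ProbabilityTheory.cond, Measure.smul_apply, smul_eq_mul]
          gcongr
          exact Measure.restrict_le_self
      _ ≤ (ENNReal.ofReal (a / (2 ^ l) ^ d))⁻¹ *
            ENNReal.ofReal (C * (1 / (b ^ k * b ^ n)) ^ d) := by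
          gcongr
          exact hup _ _ (by positivity)
      _ = ENNReal.ofReal ((a / (2 ^ l) ^ d)⁻¹ * (C * (1 / (b ^ k * b ^ n)) ^ d)) := by
          rw [← ENNReal.ofReal_inv_of_pos (by positivity), ← ENNReal.ofReal_mul (by positivity)]
      _ ≤ _ := by
          apply ENNReal.ofReal_le_ofReal
          -- Rounding `2 ^ l` up to a power of `b` costs the factor `b ^ d` in the constant.
          have h1 : ((2 : ℝ) ^ l) ^ d ≤ (b ^ (n + 1)) ^ d := by gcongr
          calc (a / (2 ^ l) ^ d)⁻¹ * (C * (1 / (b ^ k * b ^ n)) ^ d)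
              = C / a * (1 / (b ^ k * b ^ n)) ^ d * (2 ^ l) ^ d := by field_simp
            _ ≤ C / a * (1 / (b ^ k * b ^ n)) ^ d * (b ^ (n + 1)) ^ d := by gcongr
            _ = C / a * b ^ d * (1 / b ^ d) ^ k := by
              rw [div_pow, div_pow, mul_pow, pow_succ, mul_pow, one_pow, one_pow, ← pow_mul,
                ← pow_mul, ← pow_mul, mul_comm d k]
              field_simp
  have hmeas : ∀ k : ℕ, MeasurableSet {η | b ^ k * (b ^ n * dist θ η) < 1} := fun k =>
    measurableSet_lt (by fun_prop) measurable_const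
  have hpt : ∀ η, ENNReal.ofReal (K₀ * (1 + ∑ k ∈ Finset.range L,
        if b ^ k * (b ^ n * dist θ η) < 1 then g ^ (k + 1) else 0)) =
      ENNReal.ofReal K₀ * (1 + ∑ k ∈ Finset.range L,
        {η | b ^ k * (b ^ n * dist θ η) < 1}.indicator
          (fun _ => ENNReal.ofReal (g ^ (k + 1))) η) := by
    intro η
    have hnn : ∀ k ∈ Finset.range L,
        0 ≤ if b ^ k * (b ^ n * dist θ η) < 1 then g ^ (k + 1) else 0 := fun k _ => by
      split_ifs <;> positivity
    rw [ENNReal.ofReal_mul hK₀.le, ENNReal.ofReal_add zero_le_one (Finset.sum_nonneg hnn),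
      ENNReal.ofReal_one, ENNReal.ofReal_sum_of_nonneg hnn]
    congr 2
    refine Finset.sum_congr rfl fun k _ => ?_
    by_cases h : b ^ k * (b ^ n * dist θ η) < 1 <;> simp [h]
  simp_rw [hpt]
  rw [lintegral_const_mul' _ _ ENNReal.ofReal_ne_top, lintegral_add_left measurable_const,
    lintegral_finsetSum _ fun k _ => measurable_const.indicator (hmeas k)]
  simp_rw [lintegral_indicator_const (hmeas _)]
  calc _ ≤ ENNReal.ofReal K₀ * (1 + ∑ k ∈ Finset.range L, ENNReal.ofReal (g ^ (k + 1)) *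
        ENNReal.ofReal (C / a * b ^ d * (1 / b ^ d) ^ k)) := by
        gcongr
        · simp
        · exact hball _
    _ = ENNReal.ofReal (K₀ * (1 + g * (C / a * b ^ d) * ∑ k ∈ Finset.range L, ρ ^ k)) := by
        rw [ENNReal.ofReal_mul hK₀.le, ENNReal.ofReal_add zero_le_one (by positivity),
          ENNReal.ofReal_one, Finset.mul_sum, ENNReal.ofReal_sum_of_nonneg fun k _ => by positivity]
        congr 2
        refine Finset.sum_congr rfl fun k _ => ?_
        rw [← ENNReal.ofReal_mul (by positivity)]
        congr 1
        simp only [ρ, div_pow, one_pow]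
        ring
    _ ≤ _ := by
        apply ENNReal.ofReal_le_ofReal
        gcongr
        rw [← tsum_geometric_of_lt_one hρ0.le hρ1]
        exact (summable_geometric_of_lt_one hρ0.le hρ1).sum_le_tsum _ fun _ _ => by positivity

end Kernel

/-! ### Tilted laws and moments of the relative mass. -/

section Tilting

variable {Ω : Type*} [MeasurableSpace Ω] {d : ℕ} {b s : ℝ} {r : ℝ → ℝ}
  {X : ℕ → Amb d → Ω → ℝ}

/-- The weights of the fields of index `i` at the base point (`none`) and at the `k` integration
points in the tilted `k`-th moment. -/
noncomputable def tiltWeight (q : ℝ) (n k : ℕ) (i : ℕ) : Option (Fin k) → ℝ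
  | none => if i < n then q - k else 0
  | some _ => 1

/-- The exponent contributed by the fields of index `i` to the tilted `k`-th moment. -/
noncomputable def tiltExponent (b s : ℝ) (r : ℝ → ℝ) (q : ℝ) (n k : ℕ) (θ₀ : Sph d) (x : Fin k → Sph d)
    (i : ℕ) : ℝ :=
  (∑ a, ∑ a', tiltWeight q n k i a * tiltWeight q n k i a' *
    r (‖b ^ i‖ * dist (a.elim θ₀ x) (a'.elim θ₀ x))) / 2 - s ^ 2 / 2 * ∑ a, tiltWeight q n k i a

/-- The product of the first `n` fields at a base point. -/
noncomputable def baseField (P : Measure Ω) (b : ℝ) (X : ℕ → Amb d → Ω → ℝ) (n : ℕ) (θ₀ : Sph d) (ω : Ω) : ℝ :=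
  ∏ i ∈ Finset.range n, geomField P b X i θ₀ ω

/-- The normalizing constant `E (∏_{i < n} Λ^{(i)}) ^ q`. -/
noncomputable def tiltConst (s q : ℝ) (n : ℕ) : ℝ := Real.exp (n * (s ^ 2 / 2 * (q ^ 2 - q)))

/-- The law tilted by the `q`-th power of the product of the first `n` fields at `θ₀`. -/
noncomputable def tiltedLaw (P : Measure Ω) (b s : ℝ) (X : ℕ → Amb d → Ω → ℝ) (q : ℝ) (n : ℕ) (θ₀ : Sph d) :
    Measure Ω :=
  P.withDensity fun ω => ENNReal.ofReal (baseField P b X n θ₀ ω ^ q / tiltConst s q n)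

/-- The mass of `A` relative to its surface measure and to the value of the first `n` fields. -/
noncomputable def relMass (P : Measure Ω) (b : ℝ) (X : ℕ → Amb d → Ω → ℝ) (n : ℕ) (θ₀ : Sph d)
    (A : Set (Sph d)) (m : Ω → Measure (Sph d)) (ω : Ω) : ℝ≥0∞ :=
  m ω A / (ENNReal.ofReal (baseField P b X n θ₀ ω) * surf d A)

lemma tiltConst_pos (s q : ℝ) (n : ℕ) : 0 < tiltConst s q n := Real.exp_pos _

namespace IsGeomGaussianModel

variable {P : Measure Ω}

lemma baseField_pos (hX : IsGeomGaussianModel P b s r X) (n : ℕ) (θ₀ : Sph d) (ω : Ω) :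
    0 < baseField P b X n θ₀ ω :=
  Finset.prod_pos fun i _ => hX.geomField_pos i θ₀ ω

lemma measurable_baseField (hX : IsGeomGaussianModel P b s r X) (n : ℕ) (θ₀ : Sph d) :
    Measurable (baseField P b X n θ₀) := by
  unfold baseField
  exact Finset.measurable_prod _ fun i _ => hX.measurable_geomField i θ₀

lemma measurable_prodField (hX : IsGeomGaussianModel P b s r X) (N : ℕ) :
    Measurable fun z : Sph d × Ω => prodField P b X N z.1 z.2 := by
  unfold prodField
  exact Finset.measurable_prod _ fun i _ => hX.measurable_sphere i

lemma measurable_cumMeasure_apply [IsProbabilityMeasure P] (hX : IsGeomGaussianModel P b s r X)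
    (N : ℕ) {A : Set (Sph d)} (hA : MeasurableSet A) :
    Measurable fun ω => cumMeasure P b X N ω A := by
  simp_rw [cumMeasure, withDensity_apply _ hA]
  exact Measurable.lintegral_prod_left'
    (ENNReal.measurable_ofReal.comp (hX.measurable_prodField N))

lemma measurable_tiltDensity (hX : IsGeomGaussianModel P b s r X) (q : ℝ) (n : ℕ) (θ₀ : Sph d) :
    Measurable fun ω => ENNReal.ofReal (baseField P b X n θ₀ ω ^ q / tiltConst s q n) :=
  (((hX.measurable_baseField n θ₀).pow_const q).div_const _).ennreal_ofReal

lemma isProbabilityMeasure_tiltedLaw (hX : IsGeomGaussianModel P b s r X) (q : ℝ) (n : ℕ)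
    (θ₀ : Sph d) : IsProbabilityMeasure (tiltedLaw P b s X q n θ₀) := by
  refine ⟨?_⟩
  rw [tiltedLaw, withDensity_apply _ MeasurableSet.univ, Measure.restrict_univ]
  have h := hX.lintegral_prod_geomField n (fun _ (_ : Unit) => q) (fun _ => θ₀)
  simp only [Finset.univ_unique, Finset.prod_singleton, Finset.sum_singleton, dist_self, mul_zero,
    hX.r_zero] at h
  have e : ∀ ω, ENNReal.ofReal (baseField P b X n θ₀ ω ^ q / tiltConst s q n) =
      (∏ i ∈ Finset.range n, ENNReal.ofReal (geomField P b X i θ₀ ω ^ q)) *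
        ENNReal.ofReal (tiltConst s q n)⁻¹ := by
    intro ω
    rw [← ENNReal.ofReal_prod_of_nonneg fun i _ => Real.rpow_nonneg (hX.geomField_pos i θ₀ ω).le q,
      Real.finsetProd_rpow _ _ fun i _ => (hX.geomField_pos i θ₀ ω).le,
      div_eq_mul_inv, ENNReal.ofReal_mul (Real.rpow_nonneg (hX.baseField_pos n θ₀ ω).le q)]
    rfl
  simp_rw [e]
  rw [lintegral_mul_const' _ _ ENNReal.ofReal_ne_top, h, ← ENNReal.ofReal_mul (Real.exp_pos _).le]
  have : Real.exp (∑ i ∈ Finset.range n, (q * q * s ^ 2 / 2 - s ^ 2 / 2 * q)) = tiltConst s q n := by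
    rw [tiltConst, Finset.sum_const, Finset.card_range, nsmul_eq_mul]
    congr 1; ring
  rw [this, mul_inv_cancel₀ (tiltConst_pos s q n).ne', ENNReal.ofReal_one]

/-- The `k`-th power of a normalized integral is an integral over `k` independent points, and
Tonelli moves the expectation inside. The tilt contributes the power `q` of the base product and
`relMass ^ k` the power `-k`, whence the base weight `q - k`. -/
lemma lintegral_relMass_pow [IsProbabilityMeasure P] (hX : IsGeomGaussianModel P b s r X) (q : ℝ)
    {n N : ℕ} (hnN : n ≤ N + 1) (k : ℕ) (θ₀ : Sph d) {A : Set (Sph d)} (hA : MeasurableSet A)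
    (hA0 : surf d A ≠ 0) :
    ∫⁻ ω, relMass P b X n θ₀ A (cumMeasure P b X N) ω ^ k ∂(tiltedLaw P b s X q n θ₀) =
      ∫⁻ x, ENNReal.ofReal (Real.exp (∑ i ∈ Finset.range (N + 1),
        tiltExponent b s r q n k θ₀ x i - n * (s ^ 2 / 2 * (q ^ 2 - q))))
          ∂(Measure.pi fun _ : Fin k => (surf d)[|A]) := by
  have hAt : surf d A ≠ ∞ := measure_ne_top _ _
  have : IsProbabilityMeasure ((surf d)[|A]) := cond_isProbabilityMeasure hA0
  have hms : ∀ ω, Measurable fun θ => ENNReal.ofReal (prodField P b X N θ ω) := fun ω =>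
    ((hX.measurable_prodField N).comp measurable_prodMk_right).ennreal_ofReal
  have hrel : ∀ ω, relMass P b X n θ₀ A (cumMeasure P b X N) ω =
      ENNReal.ofReal (baseField P b X n θ₀ ω)⁻¹ *
        ∫⁻ θ, ENNReal.ofReal (prodField P b X N θ ω) ∂((surf d)[|A]) := by
    intro ω
    have hpos := hX.baseField_pos n θ₀ ω
    rw [relMass, cumMeasure, withDensity_apply _ hA, ProbabilityTheory.cond,
      lintegral_smul_measure, ENNReal.ofReal_inv_of_pos hpos, div_eq_mul_inv,
      ENNReal.mul_inv (Or.inr hAt) (Or.inr hA0), smul_eq_mul]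
    ring
  have hmi : Measurable fun ω => relMass P b X n θ₀ A (cumMeasure P b X N) ω ^ k := by
    unfold relMass
    exact ((hX.measurable_cumMeasure_apply N hA).div
      ((hX.measurable_baseField n θ₀).ennreal_ofReal.mul_const _)).pow_const k
  have hpt : ∀ ω, ENNReal.ofReal (baseField P b X n θ₀ ω ^ q / tiltConst s q n) *
      relMass P b X n θ₀ A (cumMeasure P b X N) ω ^ k =
      ∫⁻ x, ENNReal.ofReal (tiltConst s q n)⁻¹ *
        ∏ i ∈ Finset.range (N + 1), ENNReal.ofReal (∏ a : Option (Fin k),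
          geomField P b X i (a.elim θ₀ x) ω ^ tiltWeight q n k i a)
          ∂(Measure.pi fun _ : Fin k => (surf d)[|A]) := by
    intro ω
    have hpos := hX.baseField_pos n θ₀ ω
    rw [hrel, mul_pow, pow_lintegral_eq_lintegral_pi _ k (hms ω), ← mul_assoc,
      ← lintegral_const_mul' _ _ (ENNReal.mul_ne_top ENNReal.ofReal_ne_top
        (ENNReal.pow_ne_top ENNReal.ofReal_ne_top))]
    refine lintegral_congr fun x => ?_
    have hg : ∀ i (θ : Sph d), 0 ≤ geomField P b X i θ ω := fun i θ => (hX.geomField_pos i θ ω).le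
    rw [← ENNReal.ofReal_pow (inv_pos.2 hpos).le, ← ENNReal.ofReal_prod_of_nonneg,
      ← ENNReal.ofReal_prod_of_nonneg, ← ENNReal.ofReal_mul, ← ENNReal.ofReal_mul,
      ← ENNReal.ofReal_mul]
    · congr 1
      have h1 : ∏ i ∈ Finset.range (N + 1), ∏ a : Option (Fin k),
          geomField P b X i (a.elim θ₀ x) ω ^ tiltWeight q n k i a =
          baseField P b X n θ₀ ω ^ (q - k) * ∏ j, prodField P b X N (x j) ω := by
        simp only [Fintype.prod_option, Option.elim, tiltWeight, Real.rpow_one]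
        rw [Finset.prod_mul_distrib]
        congr 1
        · rw [baseField, ← Real.finsetProd_rpow _ _ fun i _ => hg i θ₀,
            ← Finset.prod_subset (Finset.range_subset_range.2 hnN)]
          · refine Finset.prod_congr rfl fun i hi => ?_
            rw [if_pos (Finset.mem_range.1 hi)]
          · intro i _ hi
            rw [if_neg (by simpa using hi), Real.rpow_zero]
        · rw [Finset.prod_comm]; rfl
      rw [h1, Real.rpow_sub hpos, Real.rpow_natCast, inv_pow]
      field_simp
    · exact (inv_pos.2 (tiltConst_pos s q n)).le
    · exact mul_nonneg (div_nonneg (Real.rpow_nonneg hpos.le _) (tiltConst_pos s q n).le)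
        (pow_nonneg (inv_pos.2 hpos).le _)
    · exact div_nonneg (Real.rpow_nonneg hpos.le _) (tiltConst_pos s q n).le
    · exact fun i _ => Finset.prod_nonneg fun a _ => Real.rpow_nonneg (hg _ _) _
    · exact fun j _ => Finset.prod_nonneg fun i _ => hg _ _
  rw [tiltedLaw, lintegral_withDensity_eq_lintegral_mul _ (hX.measurable_tiltDensity q n θ₀) hmi]
  simp only [Pi.mul_apply]
  simp_rw [hpt]
  rw [lintegral_lintegral_swap]
  · refine lintegral_congr fun x => ?_
    rw [lintegral_const_mul' _ _ ENNReal.ofReal_ne_top, hX.lintegral_prod_geomField (N + 1)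
      (tiltWeight q n k) (fun a => a.elim θ₀ x),
      ← ENNReal.ofReal_mul (inv_pos.2 (tiltConst_pos s q n)).le, Real.exp_sub, tiltConst,
      div_eq_mul_inv, mul_comm]
    rfl
  · refine Measurable.aemeasurable (Measurable.const_mul ?_ _)
    refine Finset.measurable_prod _ fun i _ => Measurable.ennreal_ofReal ?_
    refine Finset.measurable_prod _ fun a _ => Measurable.pow_const ?_ _
    have hz : Measurable fun z : Ω × (Fin k → Sph d) => (a.elim θ₀ z.2, z.1) := by
      refine Measurable.prodMk ?_ measurable_fst
      cases a with
      | none => exact measurable_const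
      | some j => exact (measurable_pi_apply j).comp measurable_snd
    exact (hX.measurable_sphere i).comp hz

/-- Moments of the mass of `A` in terms of the tilted law. -/
lemma lintegral_rpow_eq (hX : IsGeomGaussianModel P b s r X) {q : ℝ} (hq : 0 ≤ q) (n : ℕ)
    (θ₀ : Sph d) {A : Set (Sph d)} (hA : MeasurableSet A) (hA0 : surf d A ≠ 0)
    {m : Ω → Measure (Sph d)} (hm : Measurable m) :
    ∫⁻ ω, m ω A ^ q ∂P = ENNReal.ofReal (tiltConst s q n) * surf d A ^ q *
      ∫⁻ ω, relMass P b X n θ₀ A m ω ^ q ∂(tiltedLaw P b s X q n θ₀) := by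
  have hAt : surf d A ≠ ∞ := measure_ne_top _ _
  have hmA : Measurable fun ω => m ω A := (Measure.measurable_coe hA).comp hm
  have hmi : Measurable fun ω => relMass P b X n θ₀ A m ω ^ q := by
    unfold relMass
    exact (hmA.div ((hX.measurable_baseField n θ₀).ennreal_ofReal.mul_const _)).pow_const q
  rw [tiltedLaw, lintegral_withDensity_eq_lintegral_mul _ (hX.measurable_tiltDensity q n θ₀) hmi,
    ← lintegral_const_mul' _ _ (ENNReal.mul_ne_top ENNReal.ofReal_ne_top
      (ENNReal.rpow_ne_top_of_nonneg hq hAt))]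
  refine lintegral_congr fun ω => ?_
  have hpos := hX.baseField_pos n θ₀ ω
  have hw := tiltConst_pos s q n
  have hBq : ENNReal.ofReal (baseField P b X n θ₀ ω ^ q) ≠ 0 := by
    simpa using Real.rpow_pos_of_pos hpos q
  have hσ : surf d A ^ q ≠ 0 := by simp [ENNReal.rpow_eq_zero_iff, hA0, hAt]
  have hσt : surf d A ^ q ≠ ∞ := ENNReal.rpow_ne_top_of_nonneg hq hAt
  have hw0 : ENNReal.ofReal (tiltConst s q n) ≠ 0 := by simpa using hw
  simp only [Pi.mul_apply]
  rw [relMass, ENNReal.div_rpow_of_nonneg _ _ hq, ENNReal.mul_rpow_of_nonneg _ _ hq,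
    ENNReal.ofReal_rpow_of_pos hpos, ENNReal.ofReal_div_of_pos hw, div_eq_mul_inv, div_eq_mul_inv,
    ENNReal.mul_inv (Or.inl hBq) (Or.inl ENNReal.ofReal_ne_top)]
  set B := ENNReal.ofReal (baseField P b X n θ₀ ω ^ q)
  set W := ENNReal.ofReal (tiltConst s q n)
  set S := surf d A ^ q
  calc m ω A ^ q = (W * W⁻¹) * (S * S⁻¹) * (B * B⁻¹) * m ω A ^ q := by
        rw [ENNReal.mul_inv_cancel hw0 ENNReal.ofReal_ne_top, ENNReal.mul_inv_cancel hσ hσt,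
          ENNReal.mul_inv_cancel hBq ENNReal.ofReal_ne_top]; simp
    _ = _ := by ring

end IsGeomGaussianModel

end Tilting

/-! ### Uniform moment estimates on cells. -/

section CellMoments

lemma abs_sum_sum_mul_le {ι : Type*} [Fintype ι] [Nonempty ι] (c : ι → ℝ) (e : ι → ι → ℝ) {B ε : ℝ}
    (hB : ∑ a, |c a| ≤ B) (he : ∀ a a', |e a a'| ≤ ε) :
    |∑ a, ∑ a', c a * c a' * e a a'| ≤ B ^ 2 * ε := by
  have h0 : 0 ≤ ∑ a, |c a| := Finset.sum_nonneg fun a _ => abs_nonneg _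
  have hε : 0 ≤ ε := (abs_nonneg _).trans (he (Classical.arbitrary ι) (Classical.arbitrary ι))
  calc |∑ a, ∑ a', c a * c a' * e a a'| ≤ ∑ a, ∑ a', |c a| * |c a'| * ε := by
          refine (Finset.abs_sum_le_sum_abs _ _).trans (Finset.sum_le_sum fun a _ => ?_)
          refine (Finset.abs_sum_le_sum_abs _ _).trans (Finset.sum_le_sum fun a' _ => ?_)
          rw [abs_mul, abs_mul]
          gcongr
          exact he a a'
      _ = (∑ a, |c a|) ^ 2 * ε := by
          rw [sq, Finset.sum_mul_sum, Finset.sum_mul]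
          exact Finset.sum_congr rfl fun a _ => by rw [Finset.sum_mul]
      _ ≤ B ^ 2 * ε := by gcongr

variable {d : ℕ} {b s : ℝ} {r : ℝ → ℝ}

/-- Being independent of `k`, the total weight makes the leading low-frequency exponent the same for
every moment order, so that one normalizing constant cancels it. -/
lemma sum_tiltWeight_of_lt {q : ℝ} {n k i : ℕ} (hi : i < n) : ∑ a, tiltWeight q n k i a = q := by
  simp [tiltWeight, Fintype.sum_option, hi]

lemma sum_abs_tiltWeight_of_lt {q : ℝ} {n k i : ℕ} (hi : i < n) :
    ∑ a, |tiltWeight q n k i a| = |q - k| + k := by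
  simp [tiltWeight, Fintype.sum_option, hi]

/-- If all covariances were `s ^ 2`, the quadratic form would be `s ^ 2 * q ^ 2`; the error is the
same form evaluated on the covariance defects. -/
lemma abs_tiltExponent_sub_le {q : ℝ} {n k i : ℕ} (hi : i < n) {θ₀ : Sph d} {x : Fin k → Sph d}
    {ε : ℝ} (hr : ∀ a a' : Option (Fin k),
      |r (‖b ^ i‖ * dist (a.elim θ₀ x) (a'.elim θ₀ x)) - s ^ 2| ≤ ε) :
    |tiltExponent b s r q n k θ₀ x i - s ^ 2 / 2 * (q ^ 2 - q)| ≤ (|q - k| + k) ^ 2 / 2 * ε := by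
  have h := abs_sum_sum_mul_le (tiltWeight q n k i) _ (sum_abs_tiltWeight_of_lt hi).le hr
  have e : tiltExponent b s r q n k θ₀ x i - s ^ 2 / 2 * (q ^ 2 - q) =
      (∑ a, ∑ a', tiltWeight q n k i a * tiltWeight q n k i a' *
        (r (‖b ^ i‖ * dist (a.elim θ₀ x) (a'.elim θ₀ x)) - s ^ 2)) / 2 := by
    simp_rw [mul_sub, Finset.sum_sub_distrib, ← Finset.sum_mul, ← Finset.mul_sum,
      ← Finset.sum_mul, sum_tiltWeight_of_lt hi]
    rw [tiltExponent, sum_tiltWeight_of_lt hi]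
    ring
  rw [e, abs_div, abs_two]
  linarith

/-- The base point has weight zero here, and the diagonal terms cancel against the normalization of
the fields. -/
lemma tiltExponent_of_le {q : ℝ} {n k i : ℕ} (hi : n ≤ i) (hr0 : r 0 = s ^ 2) (hb : 0 ≤ b)
    (θ₀ : Sph d) (x : Fin k → Sph d) :
    tiltExponent b s r q n k θ₀ x i =
      (∑ y ∈ Finset.univ.offDiag, r (b ^ i * dist (x y.1) (x y.2))) / 2 := by
  have h : ∑ j, ∑ j', r (b ^ i * dist (x j) (x j')) =
      ∑ y ∈ (Finset.univ : Finset (Fin k)).offDiag, r (b ^ i * dist (x y.1) (x y.2)) +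
        k * s ^ 2 := by
    rw [← Finset.sum_product', ← Finset.diag_union_offDiag,
      Finset.sum_union (Finset.disjoint_diag_offDiag _), add_comm, Finset.sum_diag]
    simp [hr0]
  have hn : ‖b ^ i‖ = b ^ i := by rw [Real.norm_eq_abs, abs_of_nonneg (by positivity)]
  simp only [tiltExponent, Fintype.sum_option, tiltWeight, if_neg (not_lt.2 hi), zero_mul,
    mul_zero, one_mul, Finset.sum_const_zero, zero_add, Option.elim, hn, h]
  simp
  ring

/-- The covariance defects of the fields of low frequency on sets of diameter of order `b ^ (-n)`
are uniformly summable. -/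
lemma exists_sum_defect_le {R : ℝ} (hr : AntitoneOn r (Ici 0)) (hr0 : r 0 = s ^ 2) (hb : 1 < b)
    (hr_zero : Summable fun i : ℕ => s ^ 2 - r (b ^ (-(i : ℤ)))) (hR : 0 < R) :
    ∃ K : ℝ, 0 < K ∧ ∀ l n : ℕ, b ^ n ≤ (2 : ℝ) ^ l →
      ∑ i ∈ Finset.range n, (s ^ 2 - r (b ^ i * (R / 2 ^ l))) ≤ K := by
  have hb0 : 0 < b := by linarith
  -- Replacing `R` by a power of `b` brings all arguments of `r` to powers of `b`; the shift by `k₀`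
  -- does not affect summability.
  obtain ⟨k₀, hk₀⟩ := pow_unbounded_of_one_lt R hb
  set g : ℕ → ℝ := fun j => s ^ 2 - r (b ^ k₀ / b ^ j) with hg
  have hgnn : ∀ j, 0 ≤ g j := fun j => by
    have := hr (mem_Ici.2 le_rfl) (mem_Ici.2 (by positivity : 0 ≤ b ^ k₀ / b ^ j)) (by positivity)
    rw [hr0] at this
    simp only [hg]; linarith
  have hgs : Summable g := by
    rw [← summable_nat_add_iff k₀]
    refine hr_zero.congr fun j => ?_
    simp only [hg]
    congr 2
    rw [zpow_neg, zpow_natCast, pow_add]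
    field_simp
  refine ⟨∑' j, g j + 1, by have : 0 ≤ ∑' j, g j := tsum_nonneg hgnn; linarith, fun l n hn => ?_⟩
  calc ∑ i ∈ Finset.range n, (s ^ 2 - r (b ^ i * (R / 2 ^ l)))
      ≤ ∑ i ∈ Finset.range n, g (n - 1 - i) := by
        refine Finset.sum_le_sum fun i hi => ?_
        have hin := Finset.mem_range.1 hi
        -- Counted down from `n - 1`, the frequencies see the cell at geometrically decreasing
        -- scales.
        have h1 : b ^ i * (R / 2 ^ l) ≤ b ^ k₀ / b ^ (n - 1 - i) := by
          have e : b ^ n = b ^ i * b ^ (n - 1 - i) * b := by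
            rw [← pow_add, ← pow_succ]; congr 1; omega
          rw [← mul_div_assoc, div_le_div_iff₀ (by positivity) (by positivity)]
          have h3 : b ^ i * b ^ (n - 1 - i) ≤ 2 ^ l := by
            refine le_trans ?_ hn
            rw [e]
            exact le_mul_of_one_le_right (by positivity) hb.le
          calc b ^ i * R * b ^ (n - 1 - i) = R * (b ^ i * b ^ (n - 1 - i)) := by ring
            _ ≤ b ^ k₀ * 2 ^ l := by gcongr
        have := hr (mem_Ici.2 (by positivity)) (mem_Ici.2 (by positivity)) h1
        simp only [hg]; linarith
    _ = ∑ i ∈ Finset.range n, g i := Finset.sum_range_reflect g n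
    _ ≤ ∑' j, g j := hgs.sum_le_tsum _ fun j _ => hgnn j
    _ ≤ _ := by linarith

/-- On a set of diameter of order `b ^ (-n)` the total tilted exponent differs by a bounded amount
from the contribution of the fields of high frequency. -/
lemma exists_abs_sum_tiltExponent_sub_le {R : ℝ} (hr : AntitoneOn r (Ici 0)) (hr0 : r 0 = s ^ 2)
    (hb : 1 < b) (hr_zero : Summable fun i : ℕ => s ^ 2 - r (b ^ (-(i : ℤ)))) (hR : 0 < R)
    (q : ℝ) (k : ℕ) :
    ∃ K : ℝ, 0 < K ∧ ∀ (A : Set (Sph d)) (l n L : ℕ), b ^ n ≤ (2 : ℝ) ^ l →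
      (∀ x ∈ A, ∀ y ∈ A, dist x y ≤ R / 2 ^ l) → ∀ θ₀ ∈ A, ∀ x : Fin k → Sph d, (∀ j, x j ∈ A) →
      |∑ i ∈ Finset.range (n + L), tiltExponent b s r q n k θ₀ x i -
        n * (s ^ 2 / 2 * (q ^ 2 - q)) - (∑ y ∈ Finset.univ.offDiag,
          ∑ j ∈ Finset.range L, r (b ^ j * (b ^ n * dist (x y.1) (x y.2)))) / 2| ≤ K := by
  have hb0 : 0 < b := by linarith
  obtain ⟨K, hK, hsum⟩ := exists_sum_defect_le hr hr0 hb hr_zero hR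
  refine ⟨(|q - k| + k) ^ 2 / 2 * K + 1, by positivity, ?_⟩
  intro A l n L hn hA θ₀ hθ₀ x hx
  have hmem : ∀ a : Option (Fin k), a.elim θ₀ x ∈ A := by
    rintro (_ | j)
    exacts [hθ₀, hx j]
  rw [Finset.sum_range_add]
  have e1 : ∑ j ∈ Finset.range L, tiltExponent b s r q n k θ₀ x (n + j) =
      (∑ y ∈ Finset.univ.offDiag,
        ∑ j ∈ Finset.range L, r (b ^ j * (b ^ n * dist (x y.1) (x y.2)))) / 2 := by
    rw [Finset.sum_comm, Finset.sum_div]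
    refine Finset.sum_congr rfl fun j _ => ?_
    rw [tiltExponent_of_le (Nat.le_add_right n j) hr0 hb0.le]
    congr 1
    refine Finset.sum_congr rfl fun y _ => ?_
    rw [pow_add]; congr 1; ring
  have e2 : (n : ℝ) * (s ^ 2 / 2 * (q ^ 2 - q)) =
      ∑ i ∈ Finset.range n, s ^ 2 / 2 * (q ^ 2 - q) := by simp
  rw [e1, e2, add_sub_right_comm, add_sub_cancel_right, ← Finset.sum_sub_distrib]
  calc _ ≤ ∑ i ∈ Finset.range n, (|q - k| + k) ^ 2 / 2 * (s ^ 2 - r (b ^ i * (R / 2 ^ l))) := by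
        refine (Finset.abs_sum_le_sum_abs _ _).trans (Finset.sum_le_sum fun i hi => ?_)
        refine abs_tiltExponent_sub_le (Finset.mem_range.1 hi) fun a a' => ?_
        have hbi : ‖b ^ i‖ = b ^ i := by rw [Real.norm_eq_abs, abs_of_nonneg (by positivity)]
        rw [hbi]
        have h1 := hr (mem_Ici.2 le_rfl)
          (mem_Ici.2 (by positivity : 0 ≤ b ^ i * dist (a.elim θ₀ x) (a'.elim θ₀ x)))
          (by positivity)
        rw [hr0] at h1
        have h2 : b ^ i * dist (a.elim θ₀ x) (a'.elim θ₀ x) ≤ b ^ i * (R / 2 ^ l) := by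
          gcongr
          exact hA _ (hmem a) _ (hmem a')
        have h3 := hr (mem_Ici.2 (by positivity)) (mem_Ici.2 (by positivity)) h2
        rw [abs_of_nonpos (by linarith)]
        linarith
    _ = (|q - k| + k) ^ 2 / 2 * ∑ i ∈ Finset.range n, (s ^ 2 - r (b ^ i * (R / 2 ^ l))) := by
        rw [Finset.mul_sum]
    _ ≤ (|q - k| + k) ^ 2 / 2 * K := by gcongr; exact hsum l n hn
    _ ≤ _ := by linarith

variable {Ω : Type*} [MeasurableSpace Ω] {P : Measure Ω} [IsProbabilityMeasure P]
  {X : ℕ → Amb d → Ω → ℝ}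

lemma ae_pi_cond_mem {A : Set (Sph d)} (hA : MeasurableSet A) (hA0 : surf d A ≠ 0) (k : ℕ) :
    ∀ᵐ x ∂(Measure.pi fun _ : Fin k => (surf d)[|A]), ∀ j, x j ∈ A := by
  have : IsProbabilityMeasure ((surf d)[|A]) := cond_isProbabilityMeasure hA0
  rw [ae_all_iff]
  intro j
  have h1 : ∀ᵐ y ∂((surf d)[|A]), y ∈ A := ae_cond_mem hA
  exact (measurePreserving_eval (fun _ : Fin k => (surf d)[|A]) j).quasiMeasurePreserving.ae h1

/-- The `q`-th moment of the mass of a cell of level `l` is of the order of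
`E Λ_n ^ q * σ(cell) ^ q`, where `b ^ n` is of the order of `2 ^ l`. -/
theorem exists_cell_moment_bounds {p : ℕ} (hp : 2 ≤ p) (hb : 1 < b)
    (hX : IsGeomGaussianModel P b s r X) (hr : AntitoneOn r (Ici 0))
    (hbp : Real.exp ((p : ℝ) * (p - 1) / 2 * s ^ 2) < b ^ d)
    (hr_infty : Summable fun i : ℕ => r (b ^ i))
    (hr_zero : Summable fun i : ℕ => s ^ 2 - r (b ^ (-(i : ℤ))))
    (D : DyadicDecomposition d) {μ : Ω → Measure (Sph d)} (hμm : Measurable μ)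
    (hμ : ∀ l, ∀ m < D.N l, ∀ᵐ ω ∂P,
      Tendsto (fun n => cumMeasure P b X n ω (D.cell l m)) atTop (𝓝 (μ ω (D.cell l m))))
    {q : ℝ} (hq : q ∈ Icc (0 : ℝ) p) :
    ∃ c C : ℝ, 0 < c ∧ 0 < C ∧ ∀ l n : ℕ, b ^ n ≤ (2 : ℝ) ^ l → (2 : ℝ) ^ l < b ^ (n + 1) →
      ∀ m < D.N l,
        ENNReal.ofReal (tiltConst s q n) * surf d (D.cell l m) ^ q * ENNReal.ofReal c ≤
          ∫⁻ ω, μ ω (D.cell l m) ^ q ∂P ∧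
        ∫⁻ ω, μ ω (D.cell l m) ^ q ∂P ≤
          ENNReal.ofReal (tiltConst s q n) * surf d (D.cell l m) ^ q * ENNReal.ofReal C := by
  have hb0 : 0 < b := by linarith
  have hr0 := hX.r_zero
  have hp2 : (2 : ℝ) ≤ p := by exact_mod_cast hp
  obtain ⟨R, hR, hdiam⟩ := D.exists_dist_le
  obtain ⟨a, _, ha, _, hsurf⟩ := D.exists_surf_bounds
  -- Only the orders 1 and `p` are needed: the former for the lower bound, the latter for the upper
  -- bound.
  obtain ⟨K₁, hK₁, hbd₁⟩ :=
    exists_abs_sum_tiltExponent_sub_le (d := d) hr hr0 hb hr_zero hR q 1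
  obtain ⟨K₂, hK₂, hbd₂⟩ :=
    exists_abs_sum_tiltExponent_sub_le (d := d) hr hr0 hb hr_zero hR q p
  set M : ℝ := (p : ℝ) * (p - 1) / 2 with hMdef
  have hM : 0 ≤ M := by rw [hMdef]; nlinarith
  set K₀ : ℝ := Real.exp K₂ * Real.exp (M * ∑' i : ℕ, r (b ^ i))
  obtain ⟨K₃, hK₃, hker⟩ := exists_lintegral_kernel_le d (g := Real.exp (M * r 0)) (K₀ := K₀) hb
    (Real.exp_pos _) ha (by rw [hr0]; exact hbp) (by positivity)
  set c : ℝ := Real.exp (-K₁)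
  have hc : 0 < c := Real.exp_pos _
  set C : ℝ := ((Finset.univ : Finset (Fin p)).offDiag.card : ℝ) * K₃ + 1
  have hC : 0 < C := by positivity
  refine ⟨(c / 4) ^ q * (c ^ 2 / (8 * (1 + C))), 1 + C, by positivity, by positivity, ?_⟩
  intro l n hn hn' m hm
  set A := D.cell l m
  have hA : MeasurableSet A := D.measurableSet_cell l m hm
  have hAlow := (hsurf l m hm).1
  have hA0 : surf d A ≠ 0 := by
    intro h0
    have h1 := hAlow.trans h0.le
    rw [nonpos_iff_eq_zero, ENNReal.ofReal_eq_zero] at h1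
    exact absurd h1 (not_le.2 (by positivity))
  have hAt : surf d A ≠ ∞ := measure_ne_top _ _
  have : IsProbabilityMeasure ((surf d)[|A]) := cond_isProbabilityMeasure hA0
  obtain ⟨θ₀, hθ₀⟩ := D.nonempty_cell hm
  have : IsProbabilityMeasure (tiltedLaw P b s X q n θ₀) :=
    hX.isProbabilityMeasure_tiltedLaw q n θ₀
  have hden : Measurable fun ω => ENNReal.ofReal (baseField P b X n θ₀ ω) * surf d A :=
    (hX.measurable_baseField n θ₀).ennreal_ofReal.mul_const _
  have hlarge : ∀ᶠ N in atTop, ∃ L, N + 1 = n + L := by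
    filter_upwards [eventually_ge_atTop n] with N hN
    exact ⟨N + 1 - n, by omega⟩
  have key := lintegral_rpow_bounds (tiltedLaw P b s X q n θ₀)
    (Z := fun N => relMass P b X n θ₀ A (cumMeasure P b X N)) (Z' := relMass P b X n θ₀ A μ)
    (fun N => (hX.measurable_cumMeasure_apply N hA).div hden)
    (((Measure.measurable_coe hA).comp hμm).div hden) ?_ hc hC hp hq.1 hq.2 ?_ ?_
  · rw [hX.lintegral_rpow_eq hq.1 n θ₀ hA hA0 hμm]
    exact ⟨mul_le_mul_right key.1 _, mul_le_mul_right key.2 _⟩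
  -- Almost sure convergence under `P` persists under the tilted law by absolute continuity.
  · refine (withDensity_absolutelyContinuous P _).ae_le ?_
    filter_upwards [hμ l m hm] with ω hω
    exact ENNReal.Tendsto.div_const hω (Or.inr (mul_ne_zero
      (by simpa using hX.baseField_pos n θ₀ ω) hA0))
  · filter_upwards [hlarge] with N ⟨L, hL⟩
    have h1 := hX.lintegral_relMass_pow q (n := n) (N := N) (by omega) 1 θ₀ hA hA0
    simp only [pow_one] at h1
    rw [h1, hL]
    calc ENNReal.ofReal c = ∫⁻ _, ENNReal.ofReal c
          ∂(Measure.pi fun _ : Fin 1 => (surf d)[|A]) := by simp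
      _ ≤ _ := by
        refine lintegral_mono_ae ?_
        filter_upwards [ae_pi_cond_mem hA hA0 1] with x hx
        refine ENNReal.ofReal_le_ofReal (Real.exp_le_exp.2 ?_)
        have h2 := (abs_le.1 (hbd₁ A l n L hn (hdiam l m hm) θ₀ hθ₀ x hx)).1
        -- A single point forms no pairs, so only the bounded low-frequency error remains.
        have h3 : (Finset.univ : Finset (Fin 1)).offDiag = ∅ := by decide
        rw [h3, Finset.sum_empty, zero_div, sub_zero] at h2
        exact h2
  · filter_upwards [hlarge] with N ⟨L, hL⟩
    rw [hX.lintegral_relMass_pow q (n := n) (N := N) (by omega) p θ₀ hA hA0, hL]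
    set H : Sph d × Sph d → ℝ≥0∞ := fun z => ENNReal.ofReal (K₀ * (1 + ∑ k ∈ Finset.range L,
        if b ^ k * (b ^ n * dist z.1 z.2) < 1 then Real.exp (M * r 0) ^ (k + 1) else 0)) with hH
    have hHm : Measurable H := by
      refine Measurable.ennreal_ofReal (Measurable.const_mul (Measurable.const_add ?_ _) _)
      refine Finset.measurable_sum _ fun k _ => Measurable.ite ?_ measurable_const measurable_const
      exact measurableSet_lt (by fun_prop) measurable_const
    calc _ ≤ ∫⁻ x, ∑ y ∈ Finset.univ.offDiag, H (x y.1, x y.2)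
          ∂(Measure.pi fun _ : Fin p => (surf d)[|A]) := by
          refine lintegral_mono_ae ?_
          filter_upwards [ae_pi_cond_mem hA hA0 p] with x hx
          have h2 := (abs_le.1 (hbd₂ A l n L hn (hdiam l m hm) θ₀ hθ₀ x hx)).2
          have h3 := exp_half_sum_offDiag_le hp fun j j' =>
            ∑ i ∈ Finset.range L, r (b ^ i * (b ^ n * dist (x j) (x j')))
          rw [← ENNReal.ofReal_sum_of_nonneg fun y _ => mul_nonneg (by positivity)
            (add_nonneg zero_le_one (Finset.sum_nonneg fun k _ => by split_ifs <;> positivity))]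
          apply ENNReal.ofReal_le_ofReal
          calc _ ≤ Real.exp (K₂ + (∑ y ∈ Finset.univ.offDiag, ∑ j ∈ Finset.range L,
                  r (b ^ j * (b ^ n * dist (x y.1) (x y.2)))) / 2) :=
                Real.exp_le_exp.2 (by linarith)
            _ ≤ Real.exp K₂ * ∑ y ∈ Finset.univ.offDiag, Real.exp (M * ∑ j ∈ Finset.range L,
                  r (b ^ j * (b ^ n * dist (x y.1) (x y.2)))) := by
                rw [Real.exp_add]; gcongr
            _ ≤ _ := by
                rw [Finset.mul_sum]
                refine Finset.sum_le_sum fun y _ => ?_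
                rw [mul_assoc]
                gcongr
                exact exp_sum_kernel_le hr hb hr_infty hM L _ (by positivity)
      _ = ∑ y ∈ Finset.univ.offDiag, ∫⁻ x, H (x y.1, x y.2)
          ∂(Measure.pi fun _ : Fin p => (surf d)[|A]) :=
          lintegral_finsetSum _ fun y _ =>
            hHm.comp ((measurable_pi_apply _).prodMk (measurable_pi_apply _))
      _ ≤ ∑ y ∈ (Finset.univ : Finset (Fin p)).offDiag, ENNReal.ofReal K₃ :=
          Finset.sum_le_sum fun y hy => lintegral_pi_pair_le _ (Finset.mem_offDiag.1 hy).2.2 hHm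
            fun θ => hker A n l L hAlow hn' θ
      _ ≤ ENNReal.ofReal C := by
          rw [Finset.sum_const, nsmul_eq_mul, ← ENNReal.ofReal_natCast,
            ← ENNReal.ofReal_mul (by positivity)]
          exact ENNReal.ofReal_le_ofReal (by simp only [C]; linarith)

end CellMoments

/-! ### Logarithmic asymptotics and the Rényi function. -/

section Renyi

lemma tendsto_div_of_abs_sub_mul_le {x : ℕ → ℝ} {α K : ℝ} (h : ∀ l : ℕ, |x l - α * l| ≤ K) :
    Tendsto (fun l : ℕ => x l / l) atTop (𝓝 α) := by
  rw [tendsto_iff_dist_tendsto_zero]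
  refine squeeze_zero' (Eventually.of_forall fun _ => dist_nonneg) ?_
    (tendsto_const_div_atTop_nhds_zero_nat K)
  filter_upwards [eventually_gt_atTop 0] with l hl
  have hl' : (0 : ℝ) < l := by exact_mod_cast hl
  rw [Real.dist_eq]
  have : x l / l - α = (x l - α * l) / l := by field_simp
  rw [this, abs_div, abs_of_pos hl']
  gcongr
  exact h l

lemma tendsto_div_of_abs_sub_mul_le_of_abs_sub_mul_le {x y : ℕ → ℝ} {α β K K' : ℝ} (hβ : β ≠ 0)
    (hx : ∀ l : ℕ, |x l - α * l| ≤ K) (hy : ∀ l : ℕ, |y l - β * l| ≤ K') :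
    Tendsto (fun l : ℕ => x l / y l) atTop (𝓝 (α / β)) := by
  refine ((tendsto_div_of_abs_sub_mul_le hx).div (tendsto_div_of_abs_sub_mul_le hy) hβ).congr' ?_
  filter_upwards [eventually_gt_atTop 0] with l hl
  have hl' : (l : ℝ) ≠ 0 := by exact_mod_cast hl.ne'
  simp only [Pi.div_apply]
  rw [div_div_div_cancel_right₀ hl']

lemma ENNReal.log_eq_coe_of_bounds {S : ℝ≥0∞} {L U : ℝ} (hL : 0 < L) (hLS : ENNReal.ofReal L ≤ S)
    (hSU : S ≤ ENNReal.ofReal U) :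
    ENNReal.log S = (Real.log S.toReal : EReal) ∧ Real.log L ≤ Real.log S.toReal ∧
      Real.log S.toReal ≤ Real.log U := by
  have hSt : S ≠ ∞ := ne_top_of_le_ne_top ENNReal.ofReal_ne_top hSU
  have h1 : L ≤ S.toReal := (ENNReal.ofReal_le_iff_le_toReal hSt).1 hLS
  have hpos : 0 < S.toReal := hL.trans_le h1
  have hU : 0 < U := by
    by_contra hU
    rw [ENNReal.ofReal_of_nonpos (not_lt.1 hU)] at hSU
    rw [nonpos_iff_eq_zero.1 hSU] at hpos
    simp at hpos
  refine ⟨?_, Real.log_le_log hL h1,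
    Real.log_le_log hpos (ENNReal.toReal_le_of_le_ofReal hU.le hSU)⟩
  exact ENNReal.log_pos_real (by intro h; simp [h] at hpos) hSt

/-- Here `n` is the integer part of `l * log 2 / log b`, so rounding costs at most one unit. -/
lemma abs_mul_sub_le_of_pow_le {b β : ℝ} (hb : 1 < b) {l n : ℕ} (h1 : b ^ n ≤ (2 : ℝ) ^ l)
    (h2 : (2 : ℝ) ^ l < b ^ (n + 1)) : |n * β - β * Real.log 2 / Real.log b * l| ≤ |β| := by
  have hb0 : 0 < b := by linarith
  have hlb : 0 < Real.log b := Real.log_pos hb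
  have e1 := Real.log_le_log (by positivity) h1
  have e2 := Real.log_lt_log (by positivity) h2
  rw [Real.log_pow, Real.log_pow] at e1 e2
  push_cast at e2
  have e3 : (n : ℝ) * β - β * Real.log 2 / Real.log b * l =
      β * (n - l * Real.log 2 / Real.log b) := by ring
  rw [e3, abs_mul]
  refine mul_le_of_le_one_right (abs_nonneg β) (abs_le.2 ⟨?_, ?_⟩)
  · have : l * Real.log 2 / Real.log b ≤ n + 1 := by rw [div_le_iff₀ hlb]; exact e2.le
    linarith
  · have : (n : ℝ) ≤ l * Real.log 2 / Real.log b := by rw [le_div_iff₀ hlb]; exact e1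
    linarith

end Renyi

theorem corollary3 {Ω : Type*} [MeasurableSpace Ω] (P : Measure Ω) [IsProbabilityMeasure P]
    (d : ℕ) (hd : 1 ≤ d) (p : ℕ) (hp : 2 ≤ p) (b s : ℝ) (hb : 1 < b) (hs : 0 < s)
    (r : ℝ → ℝ) (X : ℕ → Amb d → Ω → ℝ)
    (hX : IsGeomGaussianModel P b s r X)
    (hr : AntitoneOn r (Set.Ici 0))
    (hbp : Real.exp ((p : ℝ) * ((p : ℝ) - 1) * s ^ 2 / (2 * (d : ℝ))) < b)
    (hr_infty : Summable fun i : ℕ => r (b ^ i))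
    (hr_zero : Summable fun i : ℕ => s ^ 2 - r (b ^ (-(i : ℤ))))
    (D : DyadicDecomposition d)
    (𝔅 : Set (Set (Sph d))) (h𝔅 : 𝔅.Countable) (h𝔅_meas : ∀ B ∈ 𝔅, MeasurableSet B)
    (hD : ∀ l, ∀ m < D.N l, D.cell l m ∈ 𝔅)
    (μ : Ω → Measure (Sph d)) (hμ : IsLimitingMeasure P b X 𝔅 μ)
    (q : ℝ) (hq : q ∈ Set.Icc (0 : ℝ) p) :
    renyi P D μ q =
      ((-(s ^ 2 / (2 * d * Real.log b)) * q ^ 2 + (s ^ 2 / (2 * d * Real.log b) + 1) * q - 1 : ℝ) :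
        EReal) := by
  have hd0 : (0 : ℝ) < d := by exact_mod_cast hd
  have hlb : 0 < Real.log b := Real.log_pos hb
  have hl2 : 0 < Real.log 2 := Real.log_pos one_lt_two
  have hq0 : 0 ≤ q := hq.1
  have hbp' : Real.exp ((p : ℝ) * (p - 1) / 2 * s ^ 2) < b ^ d := by
    have e : (p : ℝ) * (p - 1) / 2 * s ^ 2 = d * ((p : ℝ) * (p - 1) * s ^ 2 / (2 * d)) := by
      field_simp
    rw [e, Real.exp_nat_mul]
    exact pow_lt_pow_left₀ hbp (Real.exp_pos _).le (by omega)
  obtain ⟨c, C, hc, hC, hcell⟩ := exists_cell_moment_bounds hp hb hX hr hbp' hr_infty hr_zero D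
    hμ.1 (fun l m hm => hμ.2 _ (hD l m hm)) hq
  obtain ⟨a, A, ha, hA, hσ⟩ := D.exists_surf_bounds
  obtain ⟨a', A', ha', hA', hN⟩ := D.exists_card_bounds
  have hnear : ∀ l : ℕ, ∃ n : ℕ, b ^ n ≤ (2 : ℝ) ^ l ∧ (2 : ℝ) ^ l < b ^ (n + 1) := fun l =>
    exists_nat_pow_near (one_le_pow₀ one_le_two) hb
  choose n hn hn' using hnear
  set β : ℝ := s ^ 2 / 2 * (q ^ 2 - q) with hβ
  set S : ℕ → ℝ≥0∞ := fun l => ∑ m ∈ Finset.range (D.N l), ∫⁻ ω, (μ ω (D.cell l m)) ^ q ∂P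
  have hNpos : ∀ l, 0 < D.N l := fun l => by
    have : (0 : ℝ) < D.N l := lt_of_lt_of_le (by positivity) (hN l).1
    exact_mod_cast this
  -- the common form of the lower and upper bounds
  set F : ℝ → ℝ → ℝ → ℕ → ℝ := fun x y z l =>
    x * (2 ^ l) ^ d * (tiltConst s q (n l) * (y / (2 ^ l) ^ d) ^ q * z) with hF
  have hFpos : ∀ {x y z : ℝ} (l : ℕ), 0 < x → 0 < y → 0 < z → 0 < F x y z l := by
    intro x y z l hx hy hz
    have := tiltConst_pos s q (n l)
    simp only [hF]
    positivity
  -- The constants and the rounding of `n` add only a bounded term to the logarithm, so both bounds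
  -- have the same slope in `l`.
  have hFlog : ∀ {x y z : ℝ} (l : ℕ), 0 < x → 0 < y → 0 < z →
      |Real.log (F x y z l) - (d * Real.log 2 * (1 - q) + β * Real.log 2 / Real.log b) * l| ≤
        |Real.log x + q * Real.log y + Real.log z| + |β| := by
    intro x y z l hx hy hz
    have hw := tiltConst_pos s q (n l)
    have e : Real.log (F x y z l) =
        Real.log x + l * d * Real.log 2 + (n l * β + q * (Real.log y - l * d * Real.log 2) +
          Real.log z) := by
      simp only [hF]
      rw [Real.log_mul (by positivity) (by positivity), Real.log_mul (by positivity) (by positivity),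
        Real.log_mul (by positivity) (by positivity), Real.log_mul (by positivity) (by positivity),
        Real.log_rpow (by positivity), Real.log_div (by positivity) (by positivity), Real.log_pow,
        Real.log_pow, tiltConst, Real.log_exp, hβ]
      ring
    have e2 : Real.log (F x y z l) -
        (d * Real.log 2 * (1 - q) + β * Real.log 2 / Real.log b) * l =
        (Real.log x + q * Real.log y + Real.log z) +
          (n l * β - β * Real.log 2 / Real.log b * l) := by
      rw [e]; ring
    rw [e2]
    exact (abs_add_le _ _).trans
      (add_le_add le_rfl (abs_mul_sub_le_of_pow_le hb (hn l) (hn' l)))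
  have hprod : ∀ {y z : ℝ} (l : ℕ), 0 < y → 0 < z → ENNReal.ofReal (tiltConst s q (n l)) *
      ENNReal.ofReal (y / (2 ^ l) ^ d) ^ q * ENNReal.ofReal z =
        ENNReal.ofReal (tiltConst s q (n l) * (y / (2 ^ l) ^ d) ^ q * z) := by
    intro y z l hy hz
    have hw := tiltConst_pos s q (n l)
    rw [ENNReal.ofReal_rpow_of_pos (by positivity), ← ENNReal.ofReal_mul hw.le,
      ← ENNReal.ofReal_mul (by positivity)]
  have hSlow : ∀ l, ENNReal.ofReal (F a' a c l) ≤ S l := by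
    intro l
    have hw := tiltConst_pos s q (n l)
    calc ENNReal.ofReal (F a' a c l) ≤ ENNReal.ofReal (D.N l *
          (tiltConst s q (n l) * (a / (2 ^ l) ^ d) ^ q * c)) := by
          apply ENNReal.ofReal_le_ofReal
          simp only [hF]
          gcongr
          exact (hN l).1
      _ = ∑ m ∈ Finset.range (D.N l), ENNReal.ofReal (tiltConst s q (n l)) *
            ENNReal.ofReal (a / (2 ^ l) ^ d) ^ q * ENNReal.ofReal c := by
          rw [hprod l ha hc, Finset.sum_const, Finset.card_range, nsmul_eq_mul,
            ENNReal.ofReal_mul (Nat.cast_nonneg (D.N l)), ENNReal.ofReal_natCast]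
      _ ≤ S l := by
          refine Finset.sum_le_sum fun m hm => ?_
          have hm' := Finset.mem_range.1 hm
          refine le_trans ?_ (hcell l (n l) (hn l) (hn' l) m hm').1
          gcongr
          exact (hσ l m hm').1
  have hSup : ∀ l, S l ≤ ENNReal.ofReal (F A' A C l) := by
    intro l
    have hw := tiltConst_pos s q (n l)
    calc S l ≤ ∑ m ∈ Finset.range (D.N l), ENNReal.ofReal (tiltConst s q (n l)) *
            ENNReal.ofReal (A / (2 ^ l) ^ d) ^ q * ENNReal.ofReal C := by
          refine Finset.sum_le_sum fun m hm => ?_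
          have hm' := Finset.mem_range.1 hm
          refine (hcell l (n l) (hn l) (hn' l) m hm').2.trans ?_
          gcongr
          exact (hσ l m hm').2
      _ = ENNReal.ofReal (D.N l * (tiltConst s q (n l) * (A / (2 ^ l) ^ d) ^ q * C)) := by
          rw [hprod l hA hC, Finset.sum_const, Finset.card_range, nsmul_eq_mul,
            ENNReal.ofReal_mul (Nat.cast_nonneg (D.N l)), ENNReal.ofReal_natCast]
      _ ≤ _ := by
          apply ENNReal.ofReal_le_ofReal
          simp only [hF]
          gcongr
          exact (hN l).2
  have hx : ∀ l : ℕ, |Real.log (S l).toReal -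
      (d * Real.log 2 * (1 - q) + β * Real.log 2 / Real.log b) * l| ≤
      max (|Real.log a' + q * Real.log a + Real.log c| + |β|)
        (|Real.log A' + q * Real.log A + Real.log C| + |β|) := by
    intro l
    obtain ⟨-, h1, h2⟩ := ENNReal.log_eq_coe_of_bounds (hFpos l ha' ha hc) (hSlow l) (hSup l)
    have h3 := abs_le.1 (hFlog l ha' ha hc)
    have h4 := abs_le.1 (hFlog l hA' hA hC)
    refine abs_le.2 ⟨?_, ?_⟩
    · refine (neg_le_neg (le_max_left _ _)).trans ?_
      linarith [h3.1]
    · refine le_trans ?_ (le_max_right _ _)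
      linarith [h4.2]
  have hy : ∀ l : ℕ, |Real.log (surf d (D.cell l 0)).toReal - (-(d * Real.log 2)) * l| ≤
      max |Real.log a| |Real.log A| := by
    intro l
    have hlow := (hσ l 0 (hNpos l)).1
    obtain ⟨-, h1, h2⟩ := ENNReal.log_eq_coe_of_bounds (by positivity) hlow (hσ l 0 (hNpos l)).2
    rw [Real.log_div (by positivity) (by positivity), Real.log_pow, Real.log_pow] at h1 h2
    refine abs_le.2 ⟨?_, ?_⟩
    · refine (neg_le_neg (le_max_left _ _)).trans ?_
      linarith [neg_abs_le (Real.log a)]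
    · refine le_trans ?_ (le_max_right _ _)
      linarith [le_abs_self (Real.log A)]
  -- The denominator has slope `-(d * log 2)`, nonzero because `d ≥ 1`. The quotient has a genuine
  -- limit, which is then its lower limit.
  have hlim := tendsto_div_of_abs_sub_mul_le_of_abs_sub_mul_le
    (neg_ne_zero.2 (mul_pos hd0 hl2).ne') hx hy
  have hval : (d * Real.log 2 * (1 - q) + β * Real.log 2 / Real.log b) / (-(d * Real.log 2)) =
      -(s ^ 2 / (2 * d * Real.log b)) * q ^ 2 + (s ^ 2 / (2 * d * Real.log b) + 1) * q - 1 := by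
    rw [hβ]
    field_simp
    ring
  rw [hval] at hlim
  have hlimE := (continuous_coe_real_ereal.tendsto _).comp hlim
  rw [renyi, ← hlimE.liminf_eq]
  congr 1
  funext l
  have h1 := (ENNReal.log_eq_coe_of_bounds (hFpos l ha' ha hc) (hSlow l) (hSup l)).1
  have h2 := (ENNReal.log_eq_coe_of_bounds (by positivity) (hσ l 0 (hNpos l)).1
    (hσ l 0 (hNpos l)).2).1
  simp only [Function.comp_apply, EReal.coe_div]
  rw [← h1, ← h2]
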